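/- Let $H_1, H_2$ be complex Hilbert spaces, where $H_1$ is separable with orthonormal basis $(e_i)_{i\in I}$, $I=\mathbb{N}$ or $I=\{1,\dots,N\}$, and write $E_{ij}=|e_i\rangle\langle e_j|$. Let $L^1(H)$ denote the trace-class operators on $H$ with the trace norm, and $L^2(H,K)$ the Hilbert–Schmidt operators with inner product $\langle A,B\rangle=\operatorname{tr}(A^*B)$. Let $\Phi:L^1(H_1)\to L^1(H_2)$ be linear and - completely positive: $\mathrm{id}_n\otimes\Phi: L^1(\mathbb{C}^n\otimes H_1)\to L^1(\mathbb{C}^n\otimes H_2)$ maps positive operators to positive operators for all $n$; - completely bounded: $\|\Phi\|_{cb}:=\sup_n\|\mathrm{id}_n\otimes\Phi\|<\infty$; - finite rank preserving: $\Phi(s)$ has finite rank whenever $s$ has finite rank. An operator $C$ on $H_1\otimes H_2$ has entries $C_{ij}=(\langle e_i|\otimes 1)\,C\,(|e_j\rangle\otimes 1)\in B(H_2)$. A bi-partite Cholesky decomposition of $C$ is an expression $C=\hat L D\hat L^*$ with $\hat L$ lower uni-triangular ($\hat L_{ii}=1$, and $\hat L_{ij}=0$ for $j>i$) and $D$ positive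 and diagonal ($D_{ij}=0$ for $i\ne j$). Then there is a family $(\zeta_i)_{i\in I}$ in $L^2(H_1\otimes H_2,H_2)$ such that $$\Phi(E_{ij})=\zeta_i\,\zeta_j^*\qquad(i,j\in I).$$ If $\Phi$ is moreover trace-preserving, then $(\zeta_i)_{i\in I}$ is orthonormal in $L^2(H_1\otimes H_2,H_2)$. The family can be obtained by patching together bi-partite Cholesky decompositions of the Choi matrices of $\Phi$: there are operators $\hat L_{ij}\in B(H_2)$ with $\hat L_{ii}=1$, and positive finite rank operators $D_i$ on $H_2$, such that for every $n\in I$ the operators $$\hat L^{(n)}=1+\sum_{j<i\le n}E_{ij}\otimes\hat L_{ij},\qquad D^{(n)}=\sum_{i\le n}E_{ii}\otimes D_i$$ form a bi-partite Cholesky decomposition $\sum_{i,j\le n}E_{ij}\otimes\Phi(E_{ij})=\hat L^{(n)}D^{(n)}(\hat L^{(n)})^*$, and $\zeta_i=\sum_{j\le i}\langle e_j|\otimes\hat L_{ij}\sqrt{D_j}$ for all $i\in I$. Consequently there is a unique bounded operator $V_\Phi:H_1\to L^2(H_1\otimes H_2,H_2)$ with $V_\Phi e_i=\zeta_i$ for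 all $i\in I$. It is a contraction if $\Phi$ is completely contractive ($\|\Phi\|_{cb}\le 1$), and an isometry if $\Phi$ is trace-preserving. -/

import Mathlib

open scoped ENNReal InnerProductSpace TensorProduct InnerProduct

namespace ChoiCholesky

noncomputable section

set_option linter.unusedSectionVars false

universe u v w

section Basics

variable {G : Type u} [NormedAddCommGroup G] [InnerProductSpace ℂ G] [CompleteSpace G]
variable {H : Type v} [NormedAddCommGroup H] [InnerProductSpace ℂ H] [CompleteSpace H]
variable {K : Type w} [NormedAddCommGroup K] [InnerProductSpace ℂ K] [CompleteSpace K]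

/-! ### Hilbert-Schmidt and trace-class operators -/

/-- The index set of a fixed orthonormal basis of the Hilbert space `H`. -/
abbrev StdIndex (H : Type v) [NormedAddCommGroup H] [InnerProductSpace ℂ H] [CompleteSpace H] :
    Type v :=
  ↥(Classical.choose (exists_hilbertBasis ℂ H))

/-- A fixed orthonormal basis of `H`, used to write down traces and Hilbert-Schmidt norms.
None of these depends on it (see `hsNormSq_eq`). -/
def stdBasis (H : Type v) [NormedAddCommGroup H] [InnerProductSpace ℂ H] [CompleteSpace H] :
    HilbertBasis (StdIndex H) ℂ H :=
  Classical.choose (Classical.choose_spec (exists_hilbertBasis ℂ H))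

/-- The squared Hilbert-Schmidt norm `∑ₖ ‖A eₖ‖²`, with values in `[0, ∞]`. -/
def hsNormSq (A : H →L[ℂ] K) : ℝ≥0∞ := ∑' k, ‖A (stdBasis H k)‖ₑ ^ 2

/-- The trace norm `‖T‖₁ = tr |T| = ∑ₖ ⟨eₖ, |T| eₖ⟩`, with values in `[0, ∞]`, where
`|T| = (T* T)^(1/2)`. -/
def traceNorm (T : H →L[ℂ] H) : ℝ≥0∞ :=
  ∑' k, ENNReal.ofReal (RCLike.re ⟪stdBasis H k, (CFC.abs T) (stdBasis H k)⟫_ℂ)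

/-- The trace `∑ₖ ⟨eₖ, T eₖ⟩`; the series converges absolutely if `T` is trace-class. -/
def tr (T : H →L[ℂ] H) : ℂ := ∑' k, ⟪stdBasis H k, T (stdBasis H k)⟫_ℂ

theorem parseval {ι : Type*} (b : HilbertBasis ι ℂ H) (x : H) :
    ∑' i, ‖⟪b i, x⟫_ℂ‖ₑ ^ 2 = ‖x‖ₑ ^ 2 := by
  have h := b.hasSum_inner_mul_inner x x
  have h2 : HasSum (fun i => ‖⟪b i, x⟫_ℂ‖ ^ 2) (‖x‖ ^ 2) := by
    have := Complex.hasSum_re h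
    convert this using 1
    · ext i
      rw [← inner_conj_symm x (b i), mul_comm, Complex.mul_conj, Complex.ofReal_re,
        Complex.normSq_eq_norm_sq]
    · rw [inner_self_eq_norm_sq_to_K]
      norm_cast
  have h3 := ENNReal.ofReal_tsum_of_nonneg (fun i => sq_nonneg ‖⟪b i, x⟫_ℂ‖) h2.summable
  rw [h2.tsum_eq] at h3
  rw [← ofReal_norm, ← ENNReal.ofReal_pow (norm_nonneg _), h3]
  refine tsum_congr fun i => ?_
  rw [← ofReal_norm, ← ENNReal.ofReal_pow (norm_nonneg _)]

theorem tsum_adjoint {ι κ : Type*} (b : HilbertBasis ι ℂ H) (c : HilbertBasis κ ℂ K)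
    (A : H →L[ℂ] K) :
    ∑' i, ‖A (b i)‖ₑ ^ 2 = ∑' j, ‖(ContinuousLinearMap.adjoint A) (c j)‖ₑ ^ 2 := by
  simp_rw [← parseval c (A _), ← parseval b ((ContinuousLinearMap.adjoint A) _)]
  rw [ENNReal.tsum_comm]
  refine tsum_congr fun j => tsum_congr fun i => ?_
  rw [ContinuousLinearMap.adjoint_inner_right, ← ofReal_norm, ← ofReal_norm, norm_inner_symm]

theorem hsNormSq_eq {ι : Type*} (b : HilbertBasis ι ℂ H) (A : H →L[ℂ] K) :
    hsNormSq A = ∑' i, ‖A (b i)‖ₑ ^ 2 := by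
  rw [hsNormSq, tsum_adjoint (stdBasis H) (stdBasis K), tsum_adjoint b (stdBasis K)]

theorem hsNormSq_adjoint (A : H →L[ℂ] K) :
    hsNormSq (ContinuousLinearMap.adjoint A) = hsNormSq A := by
  rw [hsNormSq, hsNormSq, tsum_adjoint (stdBasis H) (stdBasis K)]

theorem hsNormSq_comp_lt_top (B : H →L[ℂ] K) {A : G →L[ℂ] H} (hA : hsNormSq A < ∞) :
    hsNormSq (B ∘L A) < ∞ := by
  have : hsNormSq (B ∘L A) ≤ ‖B‖ₑ ^ 2 * hsNormSq A := by
    rw [hsNormSq, hsNormSq, ← ENNReal.tsum_mul_left]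
    refine ENNReal.tsum_le_tsum fun k => ?_
    rw [← mul_pow]
    exact pow_le_pow_left' (B.le_opENorm _) 2
  exact this.trans_lt (ENNReal.mul_lt_top (ENNReal.pow_lt_top enorm_lt_top) hA)

theorem hsNormSq_comp_lt_top' {B : H →L[ℂ] K} (A : G →L[ℂ] H) (hB : hsNormSq B < ∞) :
    hsNormSq (B ∘L A) < ∞ := by
  rw [← hsNormSq_adjoint, ContinuousLinearMap.adjoint_comp]
  exact hsNormSq_comp_lt_top _ (by rwa [hsNormSq_adjoint])

theorem hsNormSq_add_lt_top {A B : H →L[ℂ] K} (hA : hsNormSq A < ∞) (hB : hsNormSq B < ∞) :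
    hsNormSq (A + B) < ∞ := by
  have : hsNormSq (A + B) ≤ 2 * (hsNormSq A + hsNormSq B) := by
    simp only [hsNormSq]
    rw [← ENNReal.tsum_add, ← ENNReal.tsum_mul_left]
    refine ENNReal.tsum_le_tsum fun k => ?_
    refine (pow_le_pow_left' (enorm_add_le _ _) 2).trans ?_
    simp only [enorm_eq_nnnorm]
    have h : (‖A (stdBasis H k)‖₊ + ‖B (stdBasis H k)‖₊) ^ 2 ≤
        2 * (‖A (stdBasis H k)‖₊ ^ 2 + ‖B (stdBasis H k)‖₊ ^ 2) :=
      NNReal.coe_le_coe.1 (by push_cast; exact add_sq_le)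
    exact_mod_cast h
  exact this.trans_lt (ENNReal.mul_lt_top (by simp) (ENNReal.add_lt_top.2 ⟨hA, hB⟩))

theorem hsNormSq_smul_lt_top (c : ℂ) {A : H →L[ℂ] K} (hA : hsNormSq A < ∞) :
    hsNormSq (c • A) < ∞ := by
  have : hsNormSq (c • A) = ‖c‖ₑ ^ 2 * hsNormSq A := by
    simp only [hsNormSq]
    rw [← ENNReal.tsum_mul_left]
    refine tsum_congr fun k => ?_
    simp [enorm_smul, mul_pow]
  exact this ▸ ENNReal.mul_lt_top (ENNReal.pow_lt_top enorm_lt_top) hA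

theorem enorm_inner_le_sq (x y : H) : ‖⟪x, y⟫_ℂ‖ₑ ≤ ‖x‖ₑ ^ 2 + ‖y‖ₑ ^ 2 := by
  have h : ‖⟪x, y⟫_ℂ‖ₑ ≤ ‖x‖ₑ * ‖y‖ₑ := by
    simp only [enorm_eq_nnnorm]
    exact_mod_cast nnnorm_inner_le_nnnorm x y
  refine h.trans ?_
  rcases le_total ‖x‖ₑ ‖y‖ₑ with h | h
  · exact (mul_le_mul_left h _).trans (by rw [← sq]; exact le_add_self)
  · exact (mul_le_mul_right h _).trans (by rw [← sq]; exact le_self_add)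

theorem tsum_inner_lt_top {ι : Type*} (b : HilbertBasis ι ℂ H) {A B : H →L[ℂ] K}
    (hA : hsNormSq A < ∞) (hB : hsNormSq B < ∞) :
    ∑' i, ‖⟪A (b i), B (b i)⟫_ℂ‖ₑ < ∞ := by
  rw [hsNormSq_eq b] at hA hB
  refine (ENNReal.tsum_le_tsum fun i => enorm_inner_le_sq _ _).trans_lt ?_
  rw [ENNReal.tsum_add]
  exact ENNReal.add_lt_top.2 ⟨hA, hB⟩

theorem exists_factor {R : G →L[ℂ] H} {S : G →L[ℂ] K} (h : ∀ x, ‖S x‖ ≤ ‖R x‖) :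
    ∃ W : H →L[ℂ] K, W ∘L R = S := by
  let M : Submodule ℂ H := (LinearMap.range R.toLinearMap).topologicalClosure
  let e : G →ₗ[ℂ] M := R.toLinearMap.codRestrict M
    fun x => Submodule.le_topologicalClosure _ ⟨x, rfl⟩
  have hd : DenseRange e := by
    intro ⟨y, hy⟩
    rw [closure_subtype]
    have : (Subtype.val '' Set.range e : Set H) = (LinearMap.range R.toLinearMap : Set H) := by
      ext z; constructor
      · rintro ⟨_, ⟨x, rfl⟩, rfl⟩; exact ⟨x, rfl⟩
      · rintro ⟨x, rfl⟩; exact ⟨e x, ⟨x, rfl⟩, rfl⟩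
    rw [this]
    exact hy
  have : CompleteSpace M := (Submodule.isClosed_topologicalClosure _).completeSpace_coe
  refine ⟨(S.toLinearMap.extendOfNorm e) ∘L M.orthogonalProjectionOnto, ?_⟩
  ext x
  have h1 : M.orthogonalProjectionOnto (R x) = e x :=
    Submodule.orthogonalProjectionOnto_mem_subspace_eq_self (e x)
  simp only [ContinuousLinearMap.comp_apply, h1]
  exact LinearMap.extendOfNorm_eq hd ⟨1, fun x => by rw [one_mul]; exact h x⟩ x

theorem norm_abs_apply (T : H →L[ℂ] H) (x : H) : ‖(CFC.abs T) x‖ = ‖T x‖ := by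
  have h := CFC.abs_mul_abs T
  have hs : IsSelfAdjoint (CFC.abs T) := (CFC.abs_nonneg T).isSelfAdjoint
  have h1 : ⟪(CFC.abs T) x, (CFC.abs T) x⟫_ℂ = ⟪T x, T x⟫_ℂ := by
    rw [← ContinuousLinearMap.adjoint_inner_right, ← ContinuousLinearMap.adjoint_inner_right,
      ← ContinuousLinearMap.star_eq_adjoint, ← ContinuousLinearMap.star_eq_adjoint, hs.star_eq,
      ← mul_apply_eq_comp, h, mul_apply_eq_comp]
  rw [inner_self_eq_norm_sq_to_K, inner_self_eq_norm_sq_to_K] at h1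
  exact (sq_eq_sq₀ (norm_nonneg _) (norm_nonneg _)).1 (by exact_mod_cast h1)

theorem traceNorm_lt_top_of {T : H →L[ℂ] H}
    (h : ∀ W : H →L[ℂ] H, ∑' k, ‖⟪stdBasis H k, W (T (stdBasis H k))⟫_ℂ‖ₑ < ∞) :
    traceNorm T < ∞ := by
  obtain ⟨W, hW⟩ := exists_factor (R := T) (S := CFC.abs T) fun x => (norm_abs_apply T x).le
  refine (ENNReal.tsum_le_tsum fun k => ?_).trans_lt (h W)
  rw [← hW, ← ofReal_norm]
  exact ENNReal.ofReal_le_ofReal (RCLike.re_le_norm _)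

theorem exists_hs_of_traceNorm_lt_top {T : H →L[ℂ] H} (h : traceNorm T < ∞) :
    ∃ A B : H →L[ℂ] H, hsNormSq A < ∞ ∧ hsNormSq B < ∞ ∧ T = A ∘L B := by
  obtain ⟨W, hW⟩ := exists_factor (R := CFC.abs T) (S := T) fun x => (norm_abs_apply T x).ge
  set S := CFC.sqrt (CFC.abs T) with hS
  have hSS : S * S = CFC.abs T := CFC.sqrt_mul_sqrt_self _ (CFC.abs_nonneg T)
  have hs : IsSelfAdjoint S := (CFC.sqrt_nonneg _).isSelfAdjoint
  have hS2 : hsNormSq S < ∞ := by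
    convert h using 1
    refine tsum_congr fun k => ?_
    rw [← hSS, mul_apply_eq_comp, ← ContinuousLinearMap.adjoint_inner_left,
      ← ContinuousLinearMap.star_eq_adjoint, hs.star_eq, inner_self_eq_norm_sq,
      ENNReal.ofReal_pow (norm_nonneg _), ofReal_norm]
  refine ⟨W ∘L S, S, hsNormSq_comp_lt_top W hS2, hS2, ?_⟩
  rw [ContinuousLinearMap.comp_assoc, ← ContinuousLinearMap.mul_def S S, hSS, hW]

theorem tsum_lt_top_of_hs {A : K →L[ℂ] H} {B : H →L[ℂ] K} (hA : hsNormSq A < ∞)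
    (hB : hsNormSq B < ∞) (W : H →L[ℂ] H) :
    ∑' k, ‖⟪stdBasis H k, W ((A ∘L B) (stdBasis H k))⟫_ℂ‖ₑ < ∞ := by
  have hA' : hsNormSq (ContinuousLinearMap.adjoint (W ∘L A)) < ∞ := by
    rw [hsNormSq_adjoint]; exact hsNormSq_comp_lt_top W hA
  convert tsum_inner_lt_top (stdBasis H) hA' hB using 4 with k
  rw [ContinuousLinearMap.adjoint_inner_left]
  rfl

theorem traceNorm_comp_lt_top {A : K →L[ℂ] H} {B : H →L[ℂ] K} (hA : hsNormSq A < ∞)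
    (hB : hsNormSq B < ∞) : traceNorm (A ∘L B) < ∞ :=
  traceNorm_lt_top_of (tsum_lt_top_of_hs hA hB)

theorem tsum_lt_top_of_traceNorm {T : H →L[ℂ] H} (h : traceNorm T < ∞) (W : H →L[ℂ] H) :
    ∑' k, ‖⟪stdBasis H k, W (T (stdBasis H k))⟫_ℂ‖ₑ < ∞ := by
  obtain ⟨A, B, hA, hB, rfl⟩ := exists_hs_of_traceNorm_lt_top h
  exact tsum_lt_top_of_hs hA hB W

variable (H) in
/-- The space `L¹(H)` of trace-class operators on `H`. -/
def TraceClass : Submodule ℂ (H →L[ℂ] H) where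
  carrier := {T | traceNorm T < ∞}
  zero_mem' := traceNorm_lt_top_of fun W => by simp
  add_mem' {S T} hS hT := traceNorm_lt_top_of fun W => by
    refine (ENNReal.tsum_le_tsum fun k => ?_).trans_lt
      ((ENNReal.tsum_add).trans_lt (ENNReal.add_lt_top.2
        ⟨tsum_lt_top_of_traceNorm hS W, tsum_lt_top_of_traceNorm hT W⟩))
    rw [add_apply, map_add, inner_add_right]
    exact enorm_add_le _ _
  smul_mem' c T hT := traceNorm_lt_top_of fun W => by
    convert tsum_lt_top_of_traceNorm hT (c • W) using 4 with k
    simp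

theorem comp_mem_traceClass {T : H →L[ℂ] H} (hT : T ∈ TraceClass H) (X : H →L[ℂ] K)
    (Y : K →L[ℂ] H) : X ∘L T ∘L Y ∈ TraceClass K := by
  obtain ⟨A, B, hA, hB, rfl⟩ := exists_hs_of_traceNorm_lt_top hT
  exact traceNorm_comp_lt_top (A := X ∘L A) (B := B ∘L Y) (hsNormSq_comp_lt_top X hA)
    (hsNormSq_comp_lt_top' Y hB)

theorem rankOne_mem_traceClass (x y : H) : InnerProductSpace.rankOne ℂ x y ∈ TraceClass H := by
  have h : ∀ z : H, hsNormSq (innerSL ℂ z) < ∞ := fun z => by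
    have : hsNormSq (innerSL ℂ z) = ‖z‖ₑ ^ 2 := by
      rw [← parseval (stdBasis H) z, hsNormSq]
      refine tsum_congr fun k => ?_
      rw [innerSL_apply_apply, ← ofReal_norm, ← ofReal_norm, norm_inner_symm]
    rw [this]
    exact ENNReal.pow_lt_top enorm_lt_top
  have h1 : _ ∈ TraceClass H := traceNorm_comp_lt_top (A := ContinuousLinearMap.adjoint (innerSL ℂ x))
    (B := innerSL ℂ y) (by rw [hsNormSq_adjoint]; exact h x) (h y)
  convert h1 using 1
  ext z
  refine ext_inner_left ℂ fun t => ?_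
  simp [ContinuousLinearMap.adjoint_inner_right, InnerProductSpace.rankOne_apply, inner_smul_right]

/-- The elementary operator `|x⟩⟨y|`, that is `z ↦ ⟨y, z⟩ x`, as an element of `L¹(H)`. -/
def ketbra (x y : H) : TraceClass H := ⟨InnerProductSpace.rankOne ℂ x y, rankOne_mem_traceClass x y⟩

/-- `T` has finite rank. -/
def IsFiniteRank (T : H →L[ℂ] K) : Prop :=
  FiniteDimensional ℂ (LinearMap.range T.toLinearMap)

/-- The underlying vector space of `L²(H, K)`: bounded operators of finite Hilbert-Schmidt norm. -/
def hsSubmodule (H : Type v) [NormedAddCommGroup H] [InnerProductSpace ℂ H] [CompleteSpace H]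
    (K : Type w) [NormedAddCommGroup K] [InnerProductSpace ℂ K] [CompleteSpace K] :
    Submodule ℂ (H →L[ℂ] K) where
  carrier := {A | hsNormSq A < ∞}
  zero_mem' := by simp [hsNormSq]
  add_mem' := hsNormSq_add_lt_top
  smul_mem' c _ := hsNormSq_smul_lt_top c

/-- The space `L²(H, K)` of Hilbert-Schmidt operators. It is a type of its own, so that it carries
the Hilbert-Schmidt norm and not the operator norm. -/
def HilbertSchmidt (H : Type v) [NormedAddCommGroup H] [InnerProductSpace ℂ H] [CompleteSpace H]
    (K : Type w) [NormedAddCommGroup K] [InnerProductSpace ℂ K] [CompleteSpace K] :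
    Type (max v w) :=
  ↥(hsSubmodule H K)

namespace HilbertSchmidt

instance : AddCommGroup (HilbertSchmidt H K) := inferInstanceAs (AddCommGroup ↥(hsSubmodule H K))

instance : Module ℂ (HilbertSchmidt H K) := inferInstanceAs (Module ℂ ↥(hsSubmodule H K))

/-- The bounded operator underlying a Hilbert-Schmidt operator. -/
def toCLM : HilbertSchmidt H K →ₗ[ℂ] (H →L[ℂ] K) := (hsSubmodule H K).subtype

theorem toCLM_injective : Function.Injective (toCLM : HilbertSchmidt H K → (H →L[ℂ] K)) :=
  Subtype.val_injective

theorem hsNormSq_toCLM_lt_top (A : HilbertSchmidt H K) : hsNormSq A.toCLM < ∞ := A.2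

theorem summable_inner (A B : HilbertSchmidt H K) :
    Summable fun k => ⟪A.toCLM (stdBasis H k), B.toCLM (stdBasis H k)⟫_ℂ := by
  refine Summable.of_enorm ?_
  exact (tsum_inner_lt_top (stdBasis H) A.hsNormSq_toCLM_lt_top B.hsNormSq_toCLM_lt_top).ne

/-- The Hilbert-Schmidt inner product `⟨A, B⟩ = ∑ₖ ⟨A eₖ, B eₖ⟩ = tr(A* B)`. -/
abbrev core : InnerProductSpace.Core ℂ (HilbertSchmidt H K) where
  inner A B := ∑' k, ⟪A.toCLM (stdBasis H k), B.toCLM (stdBasis H k)⟫_ℂ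
  conj_inner_symm A B := by
    rw [Complex.conj_tsum]
    simp
  re_inner_nonneg A := by
    rw [RCLike.re_eq_complex_re, Complex.re_tsum (summable_inner A A)]
    exact tsum_nonneg fun k => inner_self_nonneg (𝕜 := ℂ)
  add_left A B C := by
    rw [← (summable_inner A C).tsum_add (summable_inner B C)]
    refine tsum_congr fun k => ?_
    rw [map_add, add_apply, inner_add_left]
  smul_left A B r := by
    rw [← tsum_mul_left]
    refine tsum_congr fun k => ?_
    rw [map_smul, smul_apply, inner_smul_left]
  definite A h := by
    have h1 := congrArg Complex.re h
    rw [Complex.re_tsum (summable_inner A A), Complex.zero_re] at h1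
    have h2 := (hasSum_zero_iff_of_nonneg fun k => inner_self_nonneg (𝕜 := ℂ)).1
      (by
        have h3 := (Complex.hasSum_re (summable_inner A A).hasSum).summable.hasSum
        rwa [h1] at h3)
    apply toCLM_injective
    rw [map_zero]
    refine ContinuousLinearMap.ext_on
      (Submodule.dense_iff_topologicalClosure_eq_top.2 (stdBasis H).dense_span) ?_
    rintro _ ⟨k, rfl⟩
    have h3 : ‖A.toCLM (stdBasis H k)‖ ^ 2 = 0 := by
      rw [← inner_self_eq_norm_sq (𝕜 := ℂ)]; exact congrFun h2 k
    simpa using h3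

instance : NormedAddCommGroup (HilbertSchmidt H K) :=
  @InnerProductSpace.Core.toNormedAddCommGroup ℂ (HilbertSchmidt H K) _ _ _ core

instance : InnerProductSpace ℂ (HilbertSchmidt H K) := InnerProductSpace.ofCore core.toCore

end HilbertSchmidt

/-! ### Tensor products of Hilbert spaces -/

/-- The Hilbert space tensor product: the completion of the algebraic one. -/
abbrev HilbertTensor (H : Type v) [NormedAddCommGroup H] [InnerProductSpace ℂ H]
    (K : Type w) [NormedAddCommGroup K] [InnerProductSpace ℂ K] : Type (max v w) :=
  UniformSpace.Completion (H ⊗[ℂ] K)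

variable (K) in
/-- `|x⟩ ⊗ 1 : K → H ⊗ K`, that is `y ↦ x ⊗ y`. -/
def ketId (x : H) : K →L[ℂ] HilbertTensor H K :=
  UniformSpace.Completion.toComplL ∘L TensorProduct.mkL ℂ H K x

variable (K) in
/-- `⟨x| ⊗ 1 : H ⊗ K → K`, the adjoint of `|x⟩ ⊗ 1`; it sends `h ⊗ y` to `⟨x, h⟩ y`. -/
def braId (x : H) : HilbertTensor H K →L[ℂ] K := ContinuousLinearMap.adjoint (ketId K x)

/-- `⟨x| ⊗ A : H ⊗ K → K`. -/
def braTensor (x : H) (A : K →L[ℂ] K) : HilbertTensor H K →L[ℂ] K := A ∘L braId K x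

/-- `|x⟩⟨y| ⊗ A : H ⊗ K → H ⊗ K`. -/
def ketbraTensor (x y : H) (A : K →L[ℂ] K) : HilbertTensor H K →L[ℂ] HilbertTensor H K :=
  ketId K x ∘L A ∘L braId K y

/-- The operator `(⟨x| ⊗ 1) C (|y⟩ ⊗ 1)` on `K`. With `x = eᵢ`, `y = eⱼ` basis vectors it is the
`(i, j)`-th operator-valued entry of `C`. -/
def entry (C : HilbertTensor H K →L[ℂ] HilbertTensor H K) (x y : H) : K →L[ℂ] K :=
  braId K x ∘L C ∘L ketId K y

end Basics

section Maps

variable {H₁ : Type u} [NormedAddCommGroup H₁] [InnerProductSpace ℂ H₁] [CompleteSpace H₁]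
variable {H₂ : Type v} [NormedAddCommGroup H₂] [InnerProductSpace ℂ H₂] [CompleteSpace H₂]

/-! ### Properties of linear maps between spaces of trace-class operators -/

/-- The `i`-th standard basis vector of `ℂⁿ`. -/
abbrev stdVec {n : ℕ} (i : Fin n) : EuclideanSpace ℂ (Fin n) := EuclideanSpace.single i 1

/-- The map `idₙ ⊗ Φ : L¹(ℂⁿ ⊗ H₁) → L¹(ℂⁿ ⊗ H₂)`. An operator `s` on `ℂⁿ ⊗ H₁` is
`∑ᵢⱼ Eᵢⱼ ⊗ sᵢⱼ` with the entries `sᵢⱼ`, and it is sent to `∑ᵢⱼ Eᵢⱼ ⊗ Φ(sᵢⱼ)`. -/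
def amplification (n : ℕ) (Φ : TraceClass H₁ →ₗ[ℂ] TraceClass H₂) :
    TraceClass (HilbertTensor (EuclideanSpace ℂ (Fin n)) H₁) →ₗ[ℂ]
      TraceClass (HilbertTensor (EuclideanSpace ℂ (Fin n)) H₂) where
  toFun s := ∑ i : Fin n, ∑ j : Fin n,
    ⟨ketbraTensor (stdVec i) (stdVec j)
      (Φ ⟨entry s.1 (stdVec i) (stdVec j), comp_mem_traceClass s.2 _ _⟩).1,
      comp_mem_traceClass (Subtype.property _) _ _⟩
  map_add' s t := by
    simp only [← Finset.sum_add_distrib]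
    refine Finset.sum_congr rfl fun i _ => Finset.sum_congr rfl fun j _ => Subtype.ext ?_
    have : (⟨entry (s + t).1 (stdVec i) (stdVec j), comp_mem_traceClass (s + t).2 _ _⟩ :
        TraceClass H₁) = ⟨entry s.1 (stdVec i) (stdVec j), comp_mem_traceClass s.2 _ _⟩ +
          ⟨entry t.1 (stdVec i) (stdVec j), comp_mem_traceClass t.2 _ _⟩ :=
      Subtype.ext (by simp [entry])
    rw [this, map_add]
    simp [ketbraTensor]
  map_smul' c s := by
    simp only [Finset.smul_sum, RingHom.id_apply]
    refine Finset.sum_congr rfl fun i _ => Finset.sum_congr rfl fun j _ => Subtype.ext ?_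
    have : (⟨entry (c • s).1 (stdVec i) (stdVec j), comp_mem_traceClass (c • s).2 _ _⟩ :
        TraceClass H₁) = c • ⟨entry s.1 (stdVec i) (stdVec j), comp_mem_traceClass s.2 _ _⟩ :=
      Subtype.ext (by simp [entry])
    rw [this, map_smul]
    simp [ketbraTensor]

/-- Complete positivity: each `idₙ ⊗ Φ` maps positive operators to positive operators. -/
def IsCP (Φ : TraceClass H₁ →ₗ[ℂ] TraceClass H₂) : Prop :=
  ∀ (n : ℕ) (s : TraceClass (HilbertTensor (EuclideanSpace ℂ (Fin n)) H₁)),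
    s.1.IsPositive → (amplification n Φ s).1.IsPositive

/-- The norm `sup {‖Φ s‖₁ : ‖s‖₁ ≤ 1}` in `[0, ∞]` of a linear map between spaces `L¹`. -/
def opTraceNorm (Φ : TraceClass H₁ →ₗ[ℂ] TraceClass H₂) : ℝ≥0∞ :=
  ⨆ (s : TraceClass H₁) (_ : traceNorm s.1 ≤ 1), traceNorm (Φ s).1

/-- The completely bounded norm `sup_n ‖idₙ ⊗ Φ‖`. -/
def cbNorm (Φ : TraceClass H₁ →ₗ[ℂ] TraceClass H₂) : ℝ≥0∞ :=
  ⨆ n : ℕ, opTraceNorm (amplification n Φ)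

/-- Complete boundedness. -/
def IsCB (Φ : TraceClass H₁ →ₗ[ℂ] TraceClass H₂) : Prop := cbNorm Φ < ∞

/-- Complete contractivity. -/
def IsCC (Φ : TraceClass H₁ →ₗ[ℂ] TraceClass H₂) : Prop := cbNorm Φ ≤ 1

/-- Trace preservation. -/
def IsTP (Φ : TraceClass H₁ →ₗ[ℂ] TraceClass H₂) : Prop := ∀ s, tr (Φ s).1 = tr s.1

/-- Finite rank preservation: finite rank operators are mapped to finite rank operators. -/
def IsFP (Φ : TraceClass H₁ →ₗ[ℂ] TraceClass H₂) : Prop :=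
  ∀ s : TraceClass H₁, IsFiniteRank s.1 → IsFiniteRank (Φ s).1

/-! ### Choi matrices and bi-partite Cholesky decompositions -/

variable {I : Type w} [LinearOrder I]

/-- The Choi matrix `∑_{i, j ∈ F} Eᵢⱼ ⊗ Φ(Eᵢⱼ)`, where `Eᵢⱼ = |eᵢ⟩⟨eⱼ|`. -/
def choiMatrix (e : HilbertBasis I ℂ H₁) (Φ : TraceClass H₁ →ₗ[ℂ] TraceClass H₂) (F : Finset I) :
    HilbertTensor H₁ H₂ →L[ℂ] HilbertTensor H₁ H₂ :=
  ∑ i ∈ F, ∑ j ∈ F, ketbraTensor (e i) (e j) (Φ (ketbra (e i) (e j))).1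

/-- `L` is lower uni-triangular: `Lᵢᵢ = 1`, and `Lᵢⱼ = 0` for `i < j`. -/
def IsLowerUniTriangular (e : HilbertBasis I ℂ H₁)
    (L : HilbertTensor H₁ H₂ →L[ℂ] HilbertTensor H₁ H₂) : Prop :=
  (∀ i, entry L (e i) (e i) = 1) ∧ ∀ i j, i < j → entry L (e i) (e j) = 0

/-- `D` is diagonal: `Dᵢⱼ = 0` for `i ≠ j`. -/
def IsDiagonalOp (e : HilbertBasis I ℂ H₁)
    (D : HilbertTensor H₁ H₂ →L[ℂ] HilbertTensor H₁ H₂) : Prop :=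
  ∀ i j, i ≠ j → entry D (e i) (e j) = 0

/-- `C = L D L*` is a bi-partite Cholesky decomposition: `L` is lower uni-triangular, and `D` is
diagonal and positive. -/
structure IsBipartiteCholesky (e : HilbertBasis I ℂ H₁)
    (C L D : HilbertTensor H₁ H₂ →L[ℂ] HilbertTensor H₁ H₂) : Prop where
  lower : IsLowerUniTriangular e L
  diagonal : IsDiagonalOp e D
  positive : D.IsPositive
  eq : C = L ∘L D ∘L ContinuousLinearMap.adjoint L

variable [LocallyFiniteOrderBot I]

/-- The family `ζ` is built by patching together bi-partite Cholesky decompositions of the Choi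
matrices of `Φ` along the initial segments `{i | i ≤ n}` of `I`: there are operators `Lᵢⱼ` and
`Dᵢ ≥ 0` on `H₂`, each `Dᵢ` of finite rank, such that for each `n`
`L⁽ⁿ⁾ = 1 + ∑_{j < i ≤ n} Eᵢⱼ ⊗ Lᵢⱼ` and `D⁽ⁿ⁾ = ∑_{i ≤ n} Eᵢᵢ ⊗ Dᵢ` form such a decomposition of the
`n`-th Choi matrix, and `ζᵢ = ∑_{j ≤ i} ⟨eⱼ| ⊗ Lᵢⱼ Dⱼ^(1/2)`. -/
def IsCholeskyResolution (e : HilbertBasis I ℂ H₁) (Φ : TraceClass H₁ →ₗ[ℂ] TraceClass H₂)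
    (ζ : I → HilbertSchmidt (HilbertTensor H₁ H₂) H₂) : Prop :=
  ∃ (L : I → I → (H₂ →L[ℂ] H₂)) (D : I → (H₂ →L[ℂ] H₂)),
    (∀ i, L i i = 1) ∧
    (∀ i, (D i).IsPositive ∧ IsFiniteRank (D i)) ∧
    (∀ n, IsBipartiteCholesky e (choiMatrix e Φ (Finset.Iic n))
      (1 + ∑ i ∈ Finset.Iic n, ∑ j ∈ Finset.Iio i, ketbraTensor (e i) (e j) (L i j))
      (∑ i ∈ Finset.Iic n, ketbraTensor (e i) (e i) (D i))) ∧
    ∀ i, (ζ i).toCLM = ∑ j ∈ Finset.Iic i, braTensor (e j) (L i j ∘L CFC.sqrt (D j))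

end Maps

end

end ChoiCholesky

open ChoiCholesky

/-!
The operators `Cᵢⱼ = Φ(Eᵢⱼ)` have finite rank, and complete positivity makes them a positive kernel:
every block matrix `Φ(|xₐ⟩⟨x_b|)` is the image of a rank one positive operator under `idₙ ⊗ Φ`
(`IsCP.isPositiveKernel`). A positive kernel of finite rank operators has a block Cholesky
decomposition `C = L D L*` (`IsPositiveKernel.exists_cholesky`), obtained by block Gaussian
elimination along the index set. The pivot `D k = S k k` of a positive kernel `S` is singular in
general, but by Cauchy-Schwarz its kernel is contained in that of each `S i k`
(`IsPositiveKernel.apply_eq_zero`), and since it has finite rank it has a bounded generalized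
inverse; so `S i k = L i k ∘ D k` can be solved for `L i k`. The Schur complement that remains is
again a positive kernel of finite rank operators (`IsPositiveKernel.schurComplement`). As each
column depends only on the pivots before it, the same `L` and `D` serve all the Choi matrices, and
`ζᵢ = ∑_{j ≤ i} ⟨eⱼ| ⊗ Lᵢⱼ Dⱼ^(1/2)` satisfies `ζᵢ ζⱼ* = ∑ₖ Lᵢₖ Dₖ Lⱼₖ* = Φ(Eᵢⱼ)`.

For a finitely supported `c`, put `v = ∑ cᵢ eᵢ` and `R = ∑ cᵢ ζᵢ`. Then `R R* = Φ(|v⟩⟨v|)`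
(`map_ketbra_linearCombination`), so the squared Hilbert-Schmidt norm of `R` is the trace norm, and
the trace, of the positive operator `Φ(|v⟩⟨v|)`. It is at most `‖Φ‖_cb ‖v‖²`, and equal to `‖v‖²` if
`Φ` preserves the trace. Hence `eᵢ ↦ ζᵢ` extends to a bounded operator into the space of
Hilbert-Schmidt operators, which is complete, and this operator is a contraction or an isometry in
the respective cases. Orthonormality of `ζ` follows from the isometry.
-/

namespace ChoiCholesky

noncomputable section

set_option linter.unusedSectionVars false

/-! ### Operators of finite rank -/

section FiniteRank

variable {G : Type*} [NormedAddCommGroup G] [InnerProductSpace ℂ G] [CompleteSpace G]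
variable {H : Type*} [NormedAddCommGroup H] [InnerProductSpace ℂ H] [CompleteSpace H]
variable {K : Type*} [NormedAddCommGroup K] [InnerProductSpace ℂ K] [CompleteSpace K]

theorem IsFiniteRank.comp_right {T : H →L[ℂ] K} (hT : IsFiniteRank T) (A : G →L[ℂ] H) :
    IsFiniteRank (T ∘L A) := by
  unfold IsFiniteRank at *
  refine Submodule.finiteDimensional_of_le (S₂ := LinearMap.range T.toLinearMap) ?_
  rintro _ ⟨x, rfl⟩
  exact ⟨A x, rfl⟩

theorem IsFiniteRank.sub {S T : H →L[ℂ] K} (hS : IsFiniteRank S) (hT : IsFiniteRank T) :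
    IsFiniteRank (S - T) := by
  unfold IsFiniteRank at *
  refine Submodule.finiteDimensional_of_le
    (S₂ := LinearMap.range S.toLinearMap ⊔ LinearMap.range T.toLinearMap) ?_
  rintro _ ⟨x, rfl⟩
  exact Submodule.sub_mem _ (Submodule.mem_sup_left ⟨x, rfl⟩) (Submodule.mem_sup_right ⟨x, rfl⟩)

theorem isFiniteRank_rankOne (x y : H) : IsFiniteRank (InnerProductSpace.rankOne ℂ x y) := by
  unfold IsFiniteRank
  refine Submodule.finiteDimensional_of_le (S₂ := Submodule.span ℂ {x}) ?_
  rintro _ ⟨z, rfl⟩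
  exact Submodule.mem_span_singleton.2 ⟨⟪y, z⟫_ℂ, rfl⟩

theorem IsFiniteRank.exists_generalizedInverse {D : H →L[ℂ] K} (hD : IsFiniteRank D) :
    ∃ P : K →L[ℂ] H, D ∘L P ∘L D = D := by
  let M : Submodule ℂ K := LinearMap.range D.toLinearMap
  have : FiniteDimensional ℂ M := hD
  obtain ⟨g, hg⟩ := LinearMap.exists_rightInverse_of_surjective D.toLinearMap.rangeRestrict
    (LinearMap.range_rangeRestrict _)
  refine ⟨LinearMap.toContinuousLinearMap g ∘L M.orthogonalProjectionOnto, ?_⟩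
  ext x
  have h1 : M.orthogonalProjectionOnto (D x) = D.toLinearMap.rangeRestrict x :=
    Submodule.orthogonalProjectionOnto_mem_subspace_eq_self (D.toLinearMap.rangeRestrict x)
  have h2 := congrArg Subtype.val (LinearMap.congr_fun hg (D.toLinearMap.rangeRestrict x))
  simp only [ContinuousLinearMap.comp_apply, h1]
  exact h2

/-- The orthogonal projection onto a finite-dimensional subspace is Hilbert-Schmidt, and an operator
of finite rank is fixed by the projection onto its range. -/
theorem IsFiniteRank.exists_hs_comp_eq {T : H →L[ℂ] K} (hT : IsFiniteRank T) :
    ∃ P : K →L[ℂ] K, hsNormSq P < ∞ ∧ P ∘L T = T := by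
  have : ∀ M : Submodule ℂ K, FiniteDimensional ℂ M → LinearMap.range T.toLinearMap = M →
      ∃ P : K →L[ℂ] K, hsNormSq P < ∞ ∧ P ∘L T = T := by
    intro M hM hTM
    refine ⟨M.subtypeL ∘L M.orthogonalProjectionOnto, hsNormSq_comp_lt_top' _ ?_, ?_⟩
    · rw [hsNormSq_eq (stdOrthonormalBasis ℂ M).toHilbertBasis, tsum_fintype]
      exact ENNReal.sum_lt_top.2 fun k _ => ENNReal.pow_lt_top enorm_lt_top
    · ext x
      have hx : T x ∈ M := hTM ▸ ⟨x, rfl⟩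
      exact congrArg Subtype.val
        (Submodule.orthogonalProjectionOnto_mem_subspace_eq_self (⟨T x, hx⟩ : M))
  exact this _ hT rfl

theorem IsFiniteRank.hsNormSq_lt_top {T : H →L[ℂ] K} (hT : IsFiniteRank T) :
    hsNormSq T < ∞ := by
  obtain ⟨P, hP, h⟩ := hT.exists_hs_comp_eq
  exact h ▸ hsNormSq_comp_lt_top' T hP

theorem IsFiniteRank.tsum_inner_lt_top {T : H →L[ℂ] H} (hT : IsFiniteRank T) :
    ∑' k, ‖⟪stdBasis H k, T (stdBasis H k)⟫_ℂ‖ₑ < ∞ := by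
  obtain ⟨P, hP, h⟩ := hT.exists_hs_comp_eq
  have h1 := tsum_lt_top_of_hs hP hT.hsNormSq_lt_top 1
  rw [h] at h1
  exact h1

end FiniteRank

/-! ### Positive operator kernels and Schur complements -/

section Kernel

variable {I : Type*} {H : Type*} [NormedAddCommGroup H] [InnerProductSpace ℂ H] [CompleteSpace H]

/-- A positive kernel on `I` with values in `B(H)`: a Hermitian family `S i j` all of whose finite
block matrices are positive. The test families may repeat indices, so that a further block can be
added without asking whether it is already there. -/
structure IsPositiveKernel (S : I → I → H →L[ℂ] H) : Prop where
  adjoint_eq : ∀ i j, ContinuousLinearMap.adjoint (S i j) = S j i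
  re_nonneg : ∀ (n : ℕ) (f : Fin n → I) (x : Fin n → H),
    0 ≤ (∑ a, ∑ b, ⟪x a, S (f a) (f b) (x b)⟫_ℂ).re

/-- The diagonal block of a positive kernel controls its row: this makes the block elimination
possible although the pivot `S k k` need not be invertible. -/
theorem IsPositiveKernel.apply_eq_zero {S : I → I → H →L[ℂ] H} (hS : IsPositiveKernel S) {k : I}
    {y : H} (hy : S k k y = 0) (i : I) : S i k y = 0 := by
  by_contra hz
  set z := S i k y with hzdef
  have hpos : 0 < ‖z‖ ^ 2 := by positivity
  have key : ∀ t : ℝ, 0 ≤ (⟪z, S i i z⟫_ℂ).re + 2 * t * ‖z‖ ^ 2 := fun t => by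
    have h := hS.re_nonneg 2 ![i, k] ![z, (t : ℂ) • y]
    have h1 : ⟪y, S k i z⟫_ℂ = ((‖z‖ ^ 2 : ℝ) : ℂ) := by
      rw [← hS.adjoint_eq i k, ContinuousLinearMap.adjoint_inner_right, ← hzdef,
        inner_self_eq_norm_sq_to_K]
      norm_cast
    have h2 : ⟪z, z⟫_ℂ = ((‖z‖ ^ 2 : ℝ) : ℂ) := by
      rw [inner_self_eq_norm_sq_to_K]; norm_cast
    simp only [Fin.sum_univ_two, Matrix.cons_val_zero, Matrix.cons_val_one,
      map_smul, inner_smul_left, inner_smul_right, hy, ← hzdef, h1, h2,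
      inner_zero_right, Complex.conj_ofReal, ← Complex.ofReal_mul, Complex.add_re,
      Complex.ofReal_re, mul_zero, add_zero] at h
    linarith
  -- The form of `S` at `(z, t y)` is affine in `t`; this `t` makes it equal to `-1`.
  have h := key (-((⟪z, S i i z⟫_ℂ).re + 1) / (2 * ‖z‖ ^ 2))
  have h3 : 2 * (-((⟪z, S i i z⟫_ℂ).re + 1) / (2 * ‖z‖ ^ 2)) * ‖z‖ ^ 2 =
      -((⟪z, S i i z⟫_ℂ).re + 1) := by field_simp
  rw [h3] at h
  linarith

theorem IsPositiveKernel.isPositive {S : I → I → H →L[ℂ] H} (hS : IsPositiveKernel S) (i : I) :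
    (S i i).IsPositive := by
  refine ⟨?_, fun x => ?_⟩
  · rw [← ContinuousLinearMap.isSelfAdjoint_iff_isSymmetric, IsSelfAdjoint,
      ContinuousLinearMap.star_eq_adjoint, hS.adjoint_eq]
  · have h := hS.re_nonneg 1 (fun _ => i) (fun _ => x)
    simp only [Fin.sum_univ_one] at h
    rw [ContinuousLinearMap.reApplyInnerSelf_apply, inner_re_symm]
    exact h

open Classical in
/-- An operator `P` with `D P D = D`, or `0` if there is none; there is one if `D` has finite
rank. -/
def generalizedInverse (D : H →L[ℂ] H) : H →L[ℂ] H :=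
  if h : ∃ P : H →L[ℂ] H, D ∘L P ∘L D = D then h.choose else 0

theorem IsFiniteRank.comp_generalizedInverse_comp {D : H →L[ℂ] H} (hD : IsFiniteRank D) :
    D ∘L generalizedInverse D ∘L D = D := by
  have h := hD.exists_generalizedInverse
  rw [generalizedInverse, dif_pos h]
  exact h.choose_spec

open Classical in
/-- The multipliers that eliminate the `k`-th column of the kernel `S` by means of its pivot
`S k k`. At the pivot the multiplier is `1`, as in a uni-triangular matrix, and not the idempotent
`S k k ∘ generalizedInverse (S k k)`; composed with `S k k` both give the same. -/
def choleskyColumn (S : I → I → H →L[ℂ] H) (k i : I) : H →L[ℂ] H :=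
  if i = k then 1 else S i k ∘L generalizedInverse (S k k)

/-- The kernel `L k i ∘ S k k ∘ (L k j)*`, with `L` the multipliers `choleskyColumn S`, that the
elimination step with pivot `k` splits off from `S`. -/
def choleskyTerm (S : I → I → H →L[ℂ] H) (k i j : I) : H →L[ℂ] H :=
  choleskyColumn S k i ∘L S k k ∘L ContinuousLinearMap.adjoint (choleskyColumn S k j)

theorem choleskyColumn_self (S : I → I → H →L[ℂ] H) (k : I) : choleskyColumn S k k = 1 :=
  if_pos rfl

theorem IsPositiveKernel.choleskyColumn_comp {S : I → I → H →L[ℂ] H} (hS : IsPositiveKernel S)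
    {k : I} (hk : IsFiniteRank (S k k)) (i : I) : choleskyColumn S k i ∘L S k k = S i k := by
  by_cases h : i = k
  · subst h
    rw [choleskyColumn_self]
    rfl
  · rw [choleskyColumn, if_neg h]
    ext y
    have h1 : S k k (generalizedInverse (S k k) (S k k y) - y) = 0 := by
      rw [map_sub, sub_eq_zero]
      exact DFunLike.congr_fun hk.comp_generalizedInverse_comp y
    have h2 := hS.apply_eq_zero h1 i
    rw [map_sub, sub_eq_zero] at h2
    exact h2

theorem IsPositiveKernel.comp_adjoint_choleskyColumn {S : I → I → H →L[ℂ] H}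
    (hS : IsPositiveKernel S) {k : I} (hk : IsFiniteRank (S k k)) (i : I) :
    S k k ∘L ContinuousLinearMap.adjoint (choleskyColumn S k i) = S k i := by
  rw [← hS.adjoint_eq i k, ← hS.choleskyColumn_comp hk i, ContinuousLinearMap.adjoint_comp,
    hS.adjoint_eq]

/-- The Schur complement of a pivot of finite rank in a positive kernel is a positive kernel. -/
theorem IsPositiveKernel.schurComplement {S : I → I → H →L[ℂ] H} (hS : IsPositiveKernel S)
    {k : I} (hk : IsFiniteRank (S k k)) :
    IsPositiveKernel fun i j => S i j - choleskyTerm S k i j := by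
  constructor
  · intro i j
    rw [map_sub, hS.adjoint_eq, choleskyTerm, choleskyTerm, ContinuousLinearMap.adjoint_comp,
      ContinuousLinearMap.adjoint_comp, ContinuousLinearMap.adjoint_adjoint, hS.adjoint_eq,
      ContinuousLinearMap.comp_assoc]
  · intro n f x
    -- The quadratic form of the complement at `x` is that of `S` at `x` with one more block `-z` at
    -- the index `k`, for `z = ∑ (L k j)* x j`: this `z` minimises the latter form.
    set L := choleskyColumn S k with hL
    set z := ∑ b, ContinuousLinearMap.adjoint (L (f b)) (x b) with hz
    have hDz : S k k z = ∑ b, S k (f b) (x b) := by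
      rw [hz, map_sum]
      exact Finset.sum_congr rfl fun b _ =>
        DFunLike.congr_fun (hS.comp_adjoint_choleskyColumn hk (f b)) (x b)
    have hzD : ∀ w, ⟪S k k z, w⟫_ℂ = ∑ a, ⟪x a, S (f a) k w⟫_ℂ := fun w => by
      rw [hDz, sum_inner]
      refine Finset.sum_congr rfl fun a _ => ?_
      rw [← hS.adjoint_eq k (f a), ContinuousLinearMap.adjoint_inner_right]
    have hself : ∀ w, ⟪w, S k k z⟫_ℂ = ⟪S k k w, z⟫_ℂ := fun w => by
      nth_rewrite 1 [← hS.adjoint_eq k k]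
      rw [ContinuousLinearMap.adjoint_inner_right]
    have hT : ∑ a, ∑ b, ⟪x a, choleskyTerm S k (f a) (f b) (x b)⟫_ℂ = ⟪z, S k k z⟫_ℂ := by
      rw [hself, hzD]
      refine Finset.sum_congr rfl fun a _ => ?_
      rw [hz, map_sum, inner_sum]
      refine Finset.sum_congr rfl fun b _ => ?_
      rw [← hS.choleskyColumn_comp hk (f a)]
      rfl
    have h := hS.re_nonneg (n + 1) (Fin.cons k f) (Fin.cons (-z) x)
    have hQ : ∑ a, ∑ b, ⟪x a, (S (f a) (f b) - choleskyTerm S k (f a) (f b)) (x b)⟫_ℂ =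
        ∑ a, ∑ b, ⟪(Fin.cons (-z) x : Fin (n + 1) → H) a,
          S ((Fin.cons k f : Fin (n + 1) → I) a) ((Fin.cons k f : Fin (n + 1) → I) b)
            ((Fin.cons (-z) x : Fin (n + 1) → H) b)⟫_ℂ := by
      have hzs : ∑ b, ⟪z, S k (f b) (x b)⟫_ℂ = ⟪z, S k k z⟫_ℂ := by rw [hDz, inner_sum]
      simp only [sub_apply, inner_sub_right, Finset.sum_sub_distrib, hT, Fin.sum_univ_succ,
        Fin.cons_zero, Fin.cons_succ, Finset.sum_add_distrib, map_neg, inner_neg_left,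
        inner_neg_right, Finset.sum_neg_distrib, ← hzD, hzs, hself z]
      ring
    rwa [hQ]

end Kernel

/-! ### The block Cholesky decomposition of a positive kernel -/

section Cholesky

variable {I : Type*} [LinearOrder I] [LocallyFiniteOrderBot I]
variable {H : Type*} [NormedAddCommGroup H] [InnerProductSpace ℂ H] [CompleteSpace H]

/-- What is left of the kernel `C` after elimination with all pivots before `k`. -/
def residual (C : I → I → H →L[ℂ] H) (k i j : I) : H →L[ℂ] H :=
  C i j - ∑ m : {m // m ∈ Finset.Iio k}, choleskyTerm (residual C m.1) m.1 i j
termination_by (Finset.Iio k).card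
decreasing_by
  refine Finset.card_lt_card ?_
  have hm := Finset.mem_Iio.1 m.2
  exact (Finset.ssubset_iff_of_subset (Finset.Iio_subset_Iio hm.le)).2
    ⟨m.1, m.2, by simp⟩

theorem residual_eq (C : I → I → H →L[ℂ] H) (k i j : I) :
    residual C k i j = C i j - ∑ m ∈ Finset.Iio k, choleskyTerm (residual C m) m i j := by
  rw [residual, ← Finset.sum_coe_sort (Finset.Iio k)
    fun m => choleskyTerm (residual C m) m i j]

theorem IsPositiveKernel.residual {C : I → I → H →L[ℂ] H} (hC : IsPositiveKernel C)
    (hfin : ∀ i j, IsFiniteRank (C i j)) (k : I) :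
    IsPositiveKernel (residual C k) ∧ ∀ i j, IsFiniteRank (residual C k i j) := by
  induction hn : (Finset.Iio k).card using Nat.strong_induction_on generalizing k with
  | _ n ih =>
  rcases (Finset.Iio k).eq_empty_or_nonempty with h | h
  · have : ChoiCholesky.residual C k = C := by
      ext1 i; ext1 j
      rw [residual_eq, h, Finset.sum_empty, sub_zero]
    rw [this]
    exact ⟨hC, hfin⟩
  · -- The greatest index `p` below `k` is the last pivot.
    set p := (Finset.Iio k).max' h with hp
    have hpk : p < k := Finset.mem_Iio.1 (Finset.max'_mem _ h)
    have hIio : Finset.Iio k = insert p (Finset.Iio p) := by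
      ext m
      rw [Finset.mem_insert, Finset.mem_Iio, Finset.mem_Iio, ← le_iff_eq_or_lt]
      exact ⟨fun hm => Finset.le_max' _ _ (Finset.mem_Iio.2 hm), fun hm => hm.trans_lt hpk⟩
    obtain ⟨h1, h2⟩ := ih (Finset.Iio p).card (by
      rw [← hn, hIio, Finset.card_insert_of_notMem (by simp)]
      exact Nat.lt_succ_self _) p rfl
    have hstep : ChoiCholesky.residual C k = fun i j => ChoiCholesky.residual C p i j -
        choleskyTerm (ChoiCholesky.residual C p) p i j := by
      ext1 i; ext1 j
      rw [residual_eq, residual_eq C p, hIio, Finset.sum_insert (by simp)]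
      abel
    rw [hstep]
    refine ⟨h1.schurComplement (h2 p p), fun i j => (h2 i j).sub ?_⟩
    rw [choleskyTerm, ← ContinuousLinearMap.comp_assoc, h1.choleskyColumn_comp (h2 p p)]
    exact (h2 i p).comp_right _

/-- The block Cholesky decomposition `C = L D L*` of a positive kernel of finite rank operators. As
`L` is lower triangular, the bound `n` of the sum is arbitrary above `i` and `j`. -/
theorem IsPositiveKernel.exists_cholesky {C : I → I → H →L[ℂ] H} (hC : IsPositiveKernel C)
    (hfin : ∀ i j, IsFiniteRank (C i j)) :
    ∃ (L : I → I → H →L[ℂ] H) (D : I → H →L[ℂ] H),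
      (∀ i, L i i = 1) ∧ (∀ i j, i < j → L i j = 0) ∧
      (∀ i, (D i).IsPositive ∧ IsFiniteRank (D i)) ∧
      ∀ n i j, i ≤ n → j ≤ n →
        C i j = ∑ k ∈ Finset.Iic n, L i k ∘L D k ∘L ContinuousLinearMap.adjoint (L j k) := by
  have hR := fun k => hC.residual hfin k
  set L : I → I → H →L[ℂ] H := fun i k =>
    if i < k then 0 else choleskyColumn (ChoiCholesky.residual C k) k i with hL
  set D : I → H →L[ℂ] H := fun k => ChoiCholesky.residual C k k k with hD
  have hL0 : ∀ i j, i < j → L i j = 0 := fun i j h => if_pos h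
  have hL1 : ∀ i j, j ≤ i → L i j = choleskyColumn (ChoiCholesky.residual C j) j i :=
    fun i j h => if_neg h.not_gt
  have hDp : ∀ i, (D i).IsPositive ∧ IsFiniteRank (D i) :=
    fun i => ⟨(hR i).1.isPositive i, (hR i).2 i i⟩
  have main : ∀ n i j, i ≤ n → i ≤ j →
      C i j = ∑ k ∈ Finset.Iic n, L i k ∘L D k ∘L ContinuousLinearMap.adjoint (L j k) := by
    intro n i j hin hij
    rw [← Finset.sum_subset (Finset.Iic_subset_Iic.2 hin) fun k _ hk => by
      rw [hL0 i k (not_le.1 fun h => hk (Finset.mem_Iic.2 h)), ContinuousLinearMap.zero_comp]]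
    rw [← Finset.Iio_insert, Finset.sum_insert (by simp)]
    -- The row of the residual at its own pivot is exactly the term of that pivot.
    have h1 : L i i ∘L D i ∘L ContinuousLinearMap.adjoint (L j i) =
        ChoiCholesky.residual C i i j := by
      rw [hL1 i i le_rfl, choleskyColumn_self, hL1 j i hij]
      exact (hR i).1.comp_adjoint_choleskyColumn ((hR i).2 i i) j
    rw [h1, residual_eq, eq_comm, sub_add_eq_add_sub, sub_eq_iff_eq_add]
    congr 1
    refine Finset.sum_congr rfl fun k hk => ?_
    have hk := (Finset.mem_Iio.1 hk).le
    rw [hL1 i k hk, hL1 j k (hk.trans hij)]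
    rfl
  refine ⟨L, D, fun i => by rw [hL1 i i le_rfl, choleskyColumn_self], hL0, hDp,
    fun n i j hi hj => ?_⟩
  rcases le_total i j with h | h
  · exact main n i j hi h
  · rw [← hC.adjoint_eq j i, main n j i hj h, map_sum]
    refine Finset.sum_congr rfl fun k _ => ?_
    rw [ContinuousLinearMap.adjoint_comp, ContinuousLinearMap.adjoint_comp,
      ContinuousLinearMap.adjoint_adjoint, (hDp k).1.isSelfAdjoint.adjoint_eq,
      ContinuousLinearMap.comp_assoc]

end Cholesky

/-! ### Calculus of `|x⟩⟨y| ⊗ A` -/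

section Tensor

variable {H : Type*} [NormedAddCommGroup H] [InnerProductSpace ℂ H] [CompleteSpace H]
variable {K : Type*} [NormedAddCommGroup K] [InnerProductSpace ℂ K] [CompleteSpace K]

theorem inner_ketId (x y : H) (u v : K) :
    ⟪ketId K x u, ketId K y v⟫_ℂ = ⟪x, y⟫_ℂ * ⟪u, v⟫_ℂ := by
  have h : ∀ (x : H) (u : K), ketId K x u = ((x ⊗ₜ[ℂ] u : H ⊗[ℂ] K) : HilbertTensor H K) :=
    fun _ _ => rfl
  rw [h, h, UniformSpace.Completion.inner_coe, TensorProduct.inner_tmul]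

theorem norm_ketId (x : H) (u : K) : ‖ketId K x u‖ = ‖x‖ * ‖u‖ := by
  have h := inner_ketId x x u u
  simp only [inner_self_eq_norm_sq_to_K] at h
  have h' : ‖ketId K x u‖ ^ 2 = (‖x‖ * ‖u‖) ^ 2 := by
    rw [mul_pow]; exact_mod_cast h
  exact (sq_eq_sq₀ (norm_nonneg _) (by positivity)).1 h'

theorem adjoint_ketId (x : H) : ContinuousLinearMap.adjoint (ketId K x) = braId K x := rfl

theorem adjoint_braId (x : H) : ContinuousLinearMap.adjoint (braId K x) = ketId K x :=
  ContinuousLinearMap.adjoint_adjoint _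

theorem braId_ketId (x y : H) (u : K) : braId K x (ketId K y u) = ⟪x, y⟫_ℂ • u := by
  refine ext_inner_left ℂ fun v => ?_
  rw [braId, ContinuousLinearMap.adjoint_inner_right, inner_ketId, inner_smul_right]

theorem ketbraTensor_ketId (x y z : H) (A : K →L[ℂ] K) (u : K) :
    ketbraTensor x y A (ketId K z u) = ⟪y, z⟫_ℂ • ketId K x (A u) := by
  change ketId K x (A (braId K y (ketId K z u))) = _
  rw [braId_ketId, map_smul, map_smul]

theorem entry_ketbraTensor (x y z w : H) (A : K →L[ℂ] K) :
    entry (ketbraTensor x y A) z w = (⟪y, w⟫_ℂ * ⟪z, x⟫_ℂ) • A := by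
  ext u
  change braId K z (ketbraTensor x y A (ketId K w u)) = _
  rw [ketbraTensor_ketId, map_smul, braId_ketId, smul_smul]
  rfl

theorem entry_one (z w : H) :
    entry (1 : HilbertTensor H K →L[ℂ] HilbertTensor H K) z w = ⟪z, w⟫_ℂ • 1 := by
  ext u
  exact braId_ketId z w u

theorem entry_add (C D : HilbertTensor H K →L[ℂ] HilbertTensor H K) (z w : H) :
    entry (C + D) z w = entry C z w + entry D z w := by
  ext u
  simp [entry]

theorem entry_sum {ι : Type*} (F : Finset ι) (C : ι → HilbertTensor H K →L[ℂ] HilbertTensor H K)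
    (z w : H) : entry (∑ i ∈ F, C i) z w = ∑ i ∈ F, entry (C i) z w := by
  ext u
  simp [entry]

theorem adjoint_entry (C : HilbertTensor H K →L[ℂ] HilbertTensor H K) (z w : H) :
    ContinuousLinearMap.adjoint (entry C z w) = entry (ContinuousLinearMap.adjoint C) w z := by
  rw [entry, ContinuousLinearMap.adjoint_comp, ContinuousLinearMap.adjoint_comp, adjoint_ketId,
    adjoint_braId]
  rfl

theorem braTensor_comp_adjoint (x y : H) (A B : K →L[ℂ] K) :
    braTensor x A ∘L ContinuousLinearMap.adjoint (braTensor y B) =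
      ⟪x, y⟫_ℂ • (A ∘L ContinuousLinearMap.adjoint B) := by
  ext u
  rw [braTensor, braTensor, ContinuousLinearMap.adjoint_comp, adjoint_braId]
  change A (braId K x (ketId K y _)) = _
  rw [braId_ketId, map_smul]
  rfl

theorem entry_ketbra (v w : HilbertTensor H K) (x y : H) :
    entry (ketbra v w).1 x y = (ketbra (braId K x v) (braId K y w)).1 := by
  ext u
  change braId K x (⟪w, ketId K y u⟫_ℂ • v) = ⟪braId K y w, u⟫_ℂ • braId K x v
  rw [map_smul, ← adjoint_ketId y, ContinuousLinearMap.adjoint_inner_left]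

theorem isPositive_ketbraTensor (x : H) {A : K →L[ℂ] K} (hA : A.IsPositive) :
    (ketbraTensor x x A).IsPositive :=
  hA.conj_adjoint (ketId K x)

end Tensor

/-! ### Bi-partite Cholesky decompositions of the Choi matrices -/

section Choi

variable {H₁ : Type*} [NormedAddCommGroup H₁] [InnerProductSpace ℂ H₁] [CompleteSpace H₁]
variable {H₂ : Type*} [NormedAddCommGroup H₂] [InnerProductSpace ℂ H₂] [CompleteSpace H₂]
variable {I : Type*}

theorem inner_basis_eq_ite [DecidableEq I] (e : HilbertBasis I ℂ H₁) (i j : I) :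
    ⟪e i, e j⟫_ℂ = if i = j then 1 else 0 :=
  orthonormal_iff_ite.1 e.orthonormal i j

/-- Complete positivity makes the entries of the Choi matrix a positive kernel: the block matrix
`Φ(|xₐ⟩⟨x_b|)`, for `xₐ = g (f a)`, is the image under `idₙ ⊗ Φ` of `|v⟩⟨v|` with
`v = ∑ₐ δₐ ⊗ xₐ`. -/
theorem IsCP.isPositiveKernel {Φ : TraceClass H₁ →ₗ[ℂ] TraceClass H₂} (hΦ : IsCP Φ) (g : I → H₁) :
    IsPositiveKernel fun i j => (Φ (ketbra (g i) (g j))).1 := by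
  have key : ∀ (n : ℕ) (f : Fin n → I),
      ∃ A : HilbertTensor (EuclideanSpace ℂ (Fin n)) H₂ →L[ℂ]
        HilbertTensor (EuclideanSpace ℂ (Fin n)) H₂, A.IsPositive ∧
        ∀ a b, entry A (stdVec a) (stdVec b) = (Φ (ketbra (g (f a)) (g (f b)))).1 := by
    intro n f
    have hstd : ∀ a b : Fin n, ⟪stdVec a, stdVec b⟫_ℂ = if a = b then (1 : ℂ) else 0 :=
        fun a b => by
      simp [EuclideanSpace.inner_single_left]
    set v : HilbertTensor (EuclideanSpace ℂ (Fin n)) H₁ :=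
      ∑ a, ketId H₁ (stdVec a) (g (f a)) with hv
    have hbra : ∀ a, braId H₁ (stdVec a) v = g (f a) := fun a => by
      rw [hv, map_sum]
      simp only [braId_ketId, hstd, ite_smul, one_smul, zero_smul, Finset.sum_ite_eq,
        Finset.mem_univ, if_true]
    have hentry : ∀ a b, entry (ketbra v v).1 (stdVec a) (stdVec b) =
        (ketbra (g (f a)) (g (f b))).1 := fun a b => by
      rw [entry_ketbra, hbra, hbra]
    refine ⟨_, hΦ n (ketbra v v) ?_, fun a b => ?_⟩
    · refine (ContinuousLinearMap.isPositive_iff_complex _).2 fun w => ?_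
      change (RCLike.re ⟪⟪v, w⟫_ℂ • v, w⟫_ℂ : ℂ) = ⟪⟪v, w⟫_ℂ • v, w⟫_ℂ ∧
        0 ≤ RCLike.re ⟪⟪v, w⟫_ℂ • v, w⟫_ℂ
      rw [inner_smul_left, ← Complex.normSq_eq_conj_mul_self]
      exact ⟨rfl, Complex.normSq_nonneg _⟩
    · have h : (amplification n Φ (ketbra v v)).1 = ∑ c : Fin n, ∑ d : Fin n,
          ketbraTensor (stdVec c) (stdVec d) (Φ (ketbra (g (f c)) (g (f d)))).1 := by
        simp only [amplification, LinearMap.coe_mk, AddHom.coe_mk, AddSubmonoidClass.coe_finsetSum]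
        refine Finset.sum_congr rfl fun c _ => Finset.sum_congr rfl fun d _ => ?_
        congr 3
        exact Subtype.ext (hentry c d)
      rw [h]
      simp only [entry_sum, entry_ketbraTensor, hstd, ite_mul, one_mul, zero_mul, ite_smul,
        one_smul, zero_smul, Finset.sum_ite_eq, Finset.sum_ite_eq', Finset.mem_univ, if_true]
  constructor
  · intro i j
    obtain ⟨A, hA, h⟩ := key 2 ![i, j]
    have h1 := adjoint_entry A (stdVec 0) (stdVec 1)
    rw [hA.isSelfAdjoint.adjoint_eq, h, h] at h1
    exact h1
  · intro n f x
    obtain ⟨A, hA, h⟩ := key n f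
    have h1 := hA.inner_nonneg_right (∑ a, ketId H₂ (stdVec a) (x a))
    have h2 : ⟪∑ a, ketId H₂ (stdVec a) (x a), A (∑ a, ketId H₂ (stdVec a) (x a))⟫_ℂ =
        ∑ a, ∑ b, ⟪x a, (Φ (ketbra (g (f a)) (g (f b)))).1 (x b)⟫_ℂ := by
      rw [map_sum, sum_inner]
      refine Finset.sum_congr rfl fun a _ => ?_
      rw [inner_sum]
      refine Finset.sum_congr rfl fun b _ => ?_
      rw [← ContinuousLinearMap.adjoint_inner_right, ← h]
      rfl
    rw [h2] at h1
    exact (Complex.le_def.1 h1).1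

variable [LinearOrder I] [LocallyFiniteOrderBot I]

/-- The blocks of a Cholesky decomposition of the kernel `Φ(Eᵢⱼ)` assemble to a bi-partite Cholesky
decomposition of each Choi matrix. -/
theorem isBipartiteCholesky_of_kernel (e : HilbertBasis I ℂ H₁)
    (Φ : TraceClass H₁ →ₗ[ℂ] TraceClass H₂) {L : I → I → H₂ →L[ℂ] H₂} {D : I → H₂ →L[ℂ] H₂}
    (hL1 : ∀ i, L i i = 1) (hL0 : ∀ i j, i < j → L i j = 0) (hD : ∀ i, (D i).IsPositive) (n : I)
    (hC : ∀ i j, i ≤ n → j ≤ n → (Φ (ketbra (e i) (e j))).1 =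
      ∑ k ∈ Finset.Iic n, L i k ∘L D k ∘L ContinuousLinearMap.adjoint (L j k)) :
    IsBipartiteCholesky e (choiMatrix e Φ (Finset.Iic n))
      (1 + ∑ i ∈ Finset.Iic n, ∑ j ∈ Finset.Iio i, ketbraTensor (e i) (e j) (L i j))
      (∑ i ∈ Finset.Iic n, ketbraTensor (e i) (e i) (D i)) := by
  refine ⟨⟨fun i => ?_, fun i j hij => ?_⟩, fun i j hij => ?_,
    ContinuousLinearMap.isPositive_sum _ fun i _ => isPositive_ketbraTensor _ (hD i), ?_⟩
  · rw [entry_add, entry_one, inner_basis_eq_ite, if_pos rfl, one_smul, add_eq_left, entry_sum]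
    refine Finset.sum_eq_zero fun a _ => ?_
    rw [entry_sum]
    refine Finset.sum_eq_zero fun b hb => ?_
    rw [entry_ketbraTensor, inner_basis_eq_ite, inner_basis_eq_ite]
    have hb := Finset.mem_Iio.1 hb
    by_cases h : i = a
    · rw [if_neg (h ▸ hb.ne), zero_mul, zero_smul]
    · rw [if_neg h, mul_zero, zero_smul]
  · rw [entry_add, entry_one, inner_basis_eq_ite, if_neg hij.ne, zero_smul, zero_add,
      entry_sum]
    refine Finset.sum_eq_zero fun a _ => ?_
    rw [entry_sum]
    refine Finset.sum_eq_zero fun b hb => ?_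
    rw [entry_ketbraTensor, inner_basis_eq_ite, inner_basis_eq_ite]
    have hb := Finset.mem_Iio.1 hb
    by_cases h : i = a
    · rw [if_neg ((hb.trans_le (h ▸ le_rfl)).trans hij).ne, zero_mul, zero_smul]
    · rw [if_neg h, mul_zero, zero_smul]
  · rw [entry_sum]
    refine Finset.sum_eq_zero fun a _ => ?_
    rw [entry_ketbraTensor, inner_basis_eq_ite, inner_basis_eq_ite]
    by_cases h : i = a
    · rw [if_neg (h ▸ hij), zero_mul, zero_smul]
    · rw [if_neg h, mul_zero, zero_smul]
  · set Lop : HilbertTensor H₁ H₂ →L[ℂ] HilbertTensor H₁ H₂ :=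
      1 + ∑ i ∈ Finset.Iic n, ∑ j ∈ Finset.Iio i, ketbraTensor (e i) (e j) (L i j) with hLop
    -- The `k`-th block column of `Lop`; the summands with `i < k` vanish.
    have hcol : ∀ k ∈ Finset.Iic n, Lop ∘L ketId H₂ (e k) =
        ∑ i ∈ Finset.Iic n, ketId H₂ (e i) ∘L L i k := by
      intro k hk
      ext u
      have h1 : ∀ i, ketId H₂ (e i) (L i k u) = (if k = i then ketId H₂ (e k) u else 0) +
          ∑ j ∈ Finset.Iio i, (⟪e j, e k⟫_ℂ • ketId H₂ (e i) (L i j u)) := fun i => by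
        simp only [inner_basis_eq_ite, ite_smul, one_smul, zero_smul, Finset.sum_ite_eq',
          Finset.mem_Iio]
        rcases lt_trichotomy i k with h | h | h
        · rw [hL0 i k h, if_neg h.ne', if_neg h.not_gt, add_zero, zero_apply, map_zero]
        · subst h
          rw [hL1, if_pos rfl, if_neg (lt_irrefl _), add_zero]
          rfl
        · rw [if_neg h.ne, if_pos h, zero_add]
      have h2 : Lop (ketId H₂ (e k) u) = ketId H₂ (e k) u + ∑ i ∈ Finset.Iic n,
          ∑ j ∈ Finset.Iio i, (⟪e j, e k⟫_ℂ • ketId H₂ (e i) (L i j u)) := by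
        rw [hLop, add_apply, sum_apply]
        congr 1
        refine Finset.sum_congr rfl fun i _ => ?_
        rw [sum_apply]
        exact Finset.sum_congr rfl fun j _ => ketbraTensor_ketId _ _ _ _ _
      rw [ContinuousLinearMap.comp_apply, h2, sum_apply]
      simp only [ContinuousLinearMap.comp_apply, h1, Finset.sum_add_distrib, Finset.sum_ite_eq,
        if_pos hk]
    have hLDL : Lop ∘L (∑ k ∈ Finset.Iic n, ketbraTensor (e k) (e k) (D k)) ∘L
        ContinuousLinearMap.adjoint Lop = ∑ k ∈ Finset.Iic n, (Lop ∘L ketId H₂ (e k)) ∘L D k ∘L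
          ContinuousLinearMap.adjoint (Lop ∘L ketId H₂ (e k)) := by
      ext u
      simp only [ContinuousLinearMap.comp_apply, sum_apply, map_sum, ketbraTensor,
        ContinuousLinearMap.adjoint_comp, adjoint_ketId]
    rw [hLDL, choiMatrix]
    have hterm : ∀ k ∈ Finset.Iic n, (Lop ∘L ketId H₂ (e k)) ∘L D k ∘L
          ContinuousLinearMap.adjoint (Lop ∘L ketId H₂ (e k)) =
        ∑ i ∈ Finset.Iic n, ∑ j ∈ Finset.Iic n, ketbraTensor (e i) (e j)
          (L i k ∘L D k ∘L ContinuousLinearMap.adjoint (L j k)) := by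
      intro k hk
      rw [hcol k hk]
      ext u
      simp only [ContinuousLinearMap.comp_apply, sum_apply, map_sum, ketbraTensor,
        ContinuousLinearMap.adjoint_comp, adjoint_ketId]
      exact Finset.sum_comm
    rw [Finset.sum_congr rfl hterm]
    refine Eq.trans (Finset.sum_congr rfl fun i hi => ?_) Finset.sum_comm
    refine Eq.trans (Finset.sum_congr rfl fun j hj => ?_) Finset.sum_comm
    rw [hC i j (Finset.mem_Iic.1 hi) (Finset.mem_Iic.1 hj)]
    ext u
    simp only [ContinuousLinearMap.comp_apply, sum_apply, map_sum, ketbraTensor]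

theorem sqrt_comp_sqrt {D : H₂ →L[ℂ] H₂} (hD : D.IsPositive) :
    CFC.sqrt D ∘L ContinuousLinearMap.adjoint (CFC.sqrt D) = D := by
  have hs : IsSelfAdjoint (CFC.sqrt D) := (CFC.sqrt_nonneg _).isSelfAdjoint
  rw [hs.adjoint_eq]
  exact CFC.sqrt_mul_sqrt_self D ((ContinuousLinearMap.nonneg_iff_isPositive _).2 hD)

theorem hsNormSq_sqrt_lt_top {D : H₂ →L[ℂ] H₂} (hD : D.IsPositive) (hfin : IsFiniteRank D) :
    hsNormSq (CFC.sqrt D) < ∞ := by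
  refine (ENNReal.tsum_le_tsum fun k => ?_).trans_lt hfin.tsum_inner_lt_top
  have hs : IsSelfAdjoint (CFC.sqrt D) := (CFC.sqrt_nonneg _).isSelfAdjoint
  nth_rewrite 2 [← sqrt_comp_sqrt hD]
  rw [hs.adjoint_eq, ContinuousLinearMap.comp_apply, ← ContinuousLinearMap.adjoint_inner_left,
    hs.adjoint_eq, inner_self_eq_norm_sq_to_K, enorm_pow, ← ofReal_norm (RCLike.ofReal _),
    RCLike.norm_ofReal, abs_norm, ofReal_norm]

/-- With `ζᵢ = ∑_{j ≤ i} ⟨eⱼ| ⊗ Lᵢⱼ Dⱼ^(1/2)` the Cholesky decomposition reads `Φ(Eᵢⱼ) = ζᵢ ζⱼ*`. -/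
theorem exists_isCholeskyResolution (e : HilbertBasis I ℂ H₁)
    (Φ : TraceClass H₁ →ₗ[ℂ] TraceClass H₂) (hCP : IsCP Φ) (hFP : IsFP Φ) :
    ∃ ζ : I → HilbertSchmidt (HilbertTensor H₁ H₂) H₂, IsCholeskyResolution e Φ ζ ∧
      ∀ i j, (Φ (ketbra (e i) (e j))).1 =
        (ζ i).toCLM ∘L ContinuousLinearMap.adjoint (ζ j).toCLM := by
  obtain ⟨L, D, hL1, hL0, hD, hC⟩ := (hCP.isPositiveKernel e).exists_cholesky
    fun i j => hFP _ (isFiniteRank_rankOne (e i) (e j))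
  have hmem : ∀ i, ∑ j ∈ Finset.Iic i, braTensor (e j) (L i j ∘L CFC.sqrt (D j)) ∈
      hsSubmodule (HilbertTensor H₁ H₂) H₂ := fun i =>
    Submodule.sum_mem _ fun j _ => hsNormSq_comp_lt_top' _
      (hsNormSq_comp_lt_top _ (hsNormSq_sqrt_lt_top (hD j).1 (hD j).2))
  let ζ : I → HilbertSchmidt (HilbertTensor H₁ H₂) H₂ := fun i => ⟨_, hmem i⟩
  have hζ : ∀ i, (ζ i).toCLM = ∑ j ∈ Finset.Iic i, braTensor (e j) (L i j ∘L CFC.sqrt (D j)) :=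
    fun i => rfl
  refine ⟨ζ, ⟨L, D, hL1, hD, fun n => isBipartiteCholesky_of_kernel e Φ hL1 hL0
    (fun i => (hD i).1) n (hC n), hζ⟩, fun i j => ?_⟩
  -- As `L` is lower triangular, all the sums may be taken up to a common bound.
  have hζ' : ∀ n i, i ≤ n → (ζ i).toCLM =
      ∑ k ∈ Finset.Iic n, braTensor (e k) (L i k ∘L CFC.sqrt (D k)) := fun n i hi => by
    rw [hζ]
    refine Finset.sum_subset (Finset.Iic_subset_Iic.2 hi) fun k _ hk => ?_
    rw [hL0 i k (not_le.1 fun h => hk (Finset.mem_Iic.2 h)), ContinuousLinearMap.zero_comp]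
    exact ContinuousLinearMap.zero_comp _
  rw [hζ' (max i j) i (le_max_left _ _), hζ' (max i j) j (le_max_right _ _),
    hC (max i j) i j (le_max_left _ _) (le_max_right _ _), map_sum]
  have hexp : ∀ (F : Finset I) (A B : I → HilbertTensor H₁ H₂ →L[ℂ] H₂),
      (∑ k ∈ F, A k) ∘L (∑ l ∈ F, ContinuousLinearMap.adjoint (B l)) =
        ∑ k ∈ F, ∑ l ∈ F, A k ∘L ContinuousLinearMap.adjoint (B l) := fun F A B => by
    ext u
    simp only [ContinuousLinearMap.comp_apply, sum_apply, map_sum]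
    exact Finset.sum_comm
  rw [hexp]
  refine Finset.sum_congr rfl fun k hk => ?_
  simp only [braTensor_comp_adjoint, inner_basis_eq_ite, ite_smul, one_smul, zero_smul,
    Finset.sum_ite_eq, if_pos hk]
  rw [ContinuousLinearMap.adjoint_comp, ContinuousLinearMap.comp_assoc,
    ← ContinuousLinearMap.comp_assoc (CFC.sqrt (D k)), sqrt_comp_sqrt (hD k).1]

end Choi

/-! ### Norm and completeness of the space of Hilbert-Schmidt operators -/

section HS

variable {G : Type*} [NormedAddCommGroup G] [InnerProductSpace ℂ G] [CompleteSpace G]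
variable {H : Type*} [NormedAddCommGroup H] [InnerProductSpace ℂ H] [CompleteSpace H]
variable {K : Type*} [NormedAddCommGroup K] [InnerProductSpace ℂ K] [CompleteSpace K]

theorem hsNormSq_comp_le (B : H →L[ℂ] K) (A : G →L[ℂ] H) :
    hsNormSq (B ∘L A) ≤ ‖B‖ₑ ^ 2 * hsNormSq A := by
  rw [hsNormSq, hsNormSq, ← ENNReal.tsum_mul_left]
  refine ENNReal.tsum_le_tsum fun k => ?_
  rw [← mul_pow]
  exact pow_le_pow_left' (B.le_opENorm _) 2

theorem hsNormSq_toSpanSingleton (x : H) :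
    hsNormSq (ContinuousLinearMap.toSpanSingleton ℂ x) = ‖x‖ₑ ^ 2 := by
  rw [hsNormSq_eq (OrthonormalBasis.singleton (Fin 1) ℂ).toHilbertBasis, tsum_fintype]
  simp

/-- The operator norm is at most the Hilbert-Schmidt norm: `A x` is the composite of `A` with the
Hilbert-Schmidt operator `t ↦ t x` on `ℂ`. -/
theorem enorm_apply_sq_le (A : H →L[ℂ] K) (x : H) : ‖A x‖ₑ ^ 2 ≤ ‖x‖ₑ ^ 2 * hsNormSq A := by
  have h : A ∘L ContinuousLinearMap.toSpanSingleton ℂ x =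
      ContinuousLinearMap.toSpanSingleton ℂ (A x) := by
    ext; simp
  rw [← hsNormSq_toSpanSingleton (A x), ← h, ← hsNormSq_adjoint,
    ContinuousLinearMap.adjoint_comp, ← hsNormSq_adjoint A]
  refine (hsNormSq_comp_le _ _).trans (mul_le_mul_left (pow_le_pow_left' ?_ 2) _)
  rw [← ofReal_norm, ← ofReal_norm]
  refine ENNReal.ofReal_le_ofReal ?_
  rw [LinearIsometryEquiv.norm_map, ContinuousLinearMap.norm_toSpanSingleton]

/-- The trace norm of a positive operator, written as `R R*`. -/
theorem traceNorm_comp_adjoint (R : K →L[ℂ] H) :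
    traceNorm (R ∘L ContinuousLinearMap.adjoint R) = hsNormSq R := by
  rw [traceNorm, CFC.abs_of_nonneg _ ((ContinuousLinearMap.nonneg_iff_isPositive _).2
    (ContinuousLinearMap.isPositive_self_comp_adjoint R)), ← hsNormSq_adjoint, hsNormSq]
  refine tsum_congr fun k => ?_
  rw [ContinuousLinearMap.comp_apply, ← ContinuousLinearMap.adjoint_inner_left,
    inner_self_eq_norm_sq, ENNReal.ofReal_pow (norm_nonneg _), ofReal_norm]

theorem tr_comp_adjoint (R : K →L[ℂ] H) :
    tr (R ∘L ContinuousLinearMap.adjoint R) = ((hsNormSq R).toReal : ℂ) := by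
  rw [tr, ← hsNormSq_adjoint, hsNormSq,
    ENNReal.tsum_toReal_eq fun k => (ENNReal.pow_lt_top enorm_lt_top).ne, Complex.ofReal_tsum]
  refine tsum_congr fun k => ?_
  rw [ContinuousLinearMap.comp_apply, ← ContinuousLinearMap.adjoint_inner_left,
    inner_self_eq_norm_sq_to_K, ENNReal.toReal_pow, toReal_enorm]
  norm_cast

theorem ketbra_self_eq (x : H) : (ketbra x x).1 = ContinuousLinearMap.toSpanSingleton ℂ x ∘L
    ContinuousLinearMap.adjoint (ContinuousLinearMap.toSpanSingleton ℂ x) := by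
  ext z
  have h : ContinuousLinearMap.adjoint (ContinuousLinearMap.toSpanSingleton ℂ x) z = ⟪x, z⟫_ℂ := by
    refine ext_inner_left ℂ fun t => ?_
    rw [ContinuousLinearMap.adjoint_inner_right, ContinuousLinearMap.toSpanSingleton_apply,
      inner_smul_left]
    simp [mul_comm]
  rw [ContinuousLinearMap.comp_apply, h]
  rfl

theorem HilbertSchmidt.enorm_sq (A : HilbertSchmidt H K) : ‖A‖ₑ ^ 2 = hsNormSq A.toCLM := by
  have h : ‖A‖ ^ 2 = ∑' k, ‖A.toCLM (stdBasis H k)‖ ^ 2 := by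
    rw [← inner_self_eq_norm_sq (𝕜 := ℂ)]
    change (∑' k, ⟪A.toCLM (stdBasis H k), A.toCLM (stdBasis H k)⟫_ℂ).re = _
    rw [Complex.re_tsum (summable_inner A A)]
    exact tsum_congr fun k => inner_self_eq_norm_sq (𝕜 := ℂ) _
  have h2 : (hsNormSq A.toCLM).toReal = ‖A‖ ^ 2 := by
    rw [h, hsNormSq, ENNReal.tsum_toReal_eq fun k => (ENNReal.pow_lt_top enorm_lt_top).ne]
    simp
  rw [← ENNReal.ofReal_toReal A.hsNormSq_toCLM_lt_top.ne, h2, ENNReal.ofReal_pow (norm_nonneg _),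
    ofReal_norm]

theorem isClosed_hsNormSq_le (r : ℝ≥0∞) : IsClosed {A : H →L[ℂ] K | hsNormSq A ≤ r} := by
  have : {A : H →L[ℂ] K | hsNormSq A ≤ r} =
      ⋂ F : Finset (StdIndex H), {A | ∑ k ∈ F, ‖A (stdBasis H k)‖ₑ ^ 2 ≤ r} := by
    ext A
    simp only [Set.mem_ofPred_eq, Set.mem_iInter, hsNormSq, ENNReal.tsum_eq_iSup_sum, iSup_le_iff]
  rw [this]
  refine isClosed_iInter fun F => isClosed_le ?_ continuous_const
  refine continuous_finsetSum _ fun k _ => (ENNReal.continuous_pow 2).comp ?_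
  exact continuous_enorm.comp (ContinuousLinearMap.apply ℂ K (stdBasis H k)).continuous

theorem HilbertSchmidt.norm_toCLM_le (A : HilbertSchmidt H K) : ‖A.toCLM‖ ≤ ‖A‖ := by
  refine ContinuousLinearMap.opNorm_le_bound _ (norm_nonneg _) fun x => ?_
  have h := enorm_apply_sq_le A.toCLM x
  rw [← A.enorm_sq, ← mul_pow, ENNReal.pow_le_pow_left_iff two_ne_zero, ← ofReal_norm,
    ← ofReal_norm, ← ofReal_norm, ← ENNReal.ofReal_mul (norm_nonneg _), mul_comm] at h
  exact (ENNReal.ofReal_le_ofReal_iff (by positivity)).1 h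

/-- A Cauchy sequence converges in operator norm, and the balls of the Hilbert-Schmidt norm are
closed in that norm, so it converges in the Hilbert-Schmidt norm as well. -/
instance : CompleteSpace (HilbertSchmidt H K) := by
  refine Metric.complete_of_cauchySeq_tendsto fun u hu => ?_
  let φ : HilbertSchmidt H K →L[ℂ] (H →L[ℂ] K) :=
    HilbertSchmidt.toCLM.mkContinuous 1 fun A => by
      rw [one_mul]; exact A.norm_toCLM_le
  obtain ⟨T, hT⟩ := cauchySeq_tendsto_of_complete (φ.uniformContinuous.comp_cauchySeq hu)
  have key : ∀ ε > 0, ∃ N, ∀ m ≥ N, hsNormSq ((u m).toCLM - T) ≤ ENNReal.ofReal ε ^ 2 := by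
    intro ε hε
    obtain ⟨N, hN⟩ := Metric.cauchySeq_iff.1 hu ε hε
    refine ⟨N, fun m hm => ?_⟩
    refine (isClosed_hsNormSq_le (ENNReal.ofReal ε ^ 2)).mem_of_tendsto
      (tendsto_const_nhds.sub hT) (Filter.eventually_atTop.2 ⟨N, fun n hn => ?_⟩)
    have h : hsNormSq (u m - u n).toCLM ≤ ENNReal.ofReal ε ^ 2 := by
      rw [← HilbertSchmidt.enorm_sq, ← ofReal_norm, ← dist_eq_norm]
      exact pow_le_pow_left' (ENNReal.ofReal_le_ofReal (hN m hm n hn).le) 2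
    rwa [map_sub] at h
  obtain ⟨N, hN⟩ := key 1 one_pos
  have hmem : T ∈ hsSubmodule H K := by
    have h1 : (u N).toCLM - T ∈ hsSubmodule H K :=
      (hN N le_rfl).trans_lt (ENNReal.pow_lt_top ENNReal.ofReal_lt_top)
    have h2 := Submodule.sub_mem _ (u N).2 h1
    rwa [show (u N).1 - ((u N).toCLM - T) = T from sub_sub_cancel _ _] at h2
  let A : HilbertSchmidt H K := ⟨T, hmem⟩
  refine ⟨A, Metric.tendsto_atTop'.2 fun ε hε => ?_⟩
  obtain ⟨N, hN⟩ := key (ε / 2) (half_pos hε)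
  refine ⟨N, fun m hm => ?_⟩
  have h := hN m hm.le
  have h1 : (u m).toCLM - T = (u m - A).toCLM := by rw [map_sub]; rfl
  rw [h1, ← HilbertSchmidt.enorm_sq, ENNReal.pow_le_pow_left_iff two_ne_zero, ← ofReal_norm,
    ENNReal.ofReal_le_ofReal_iff (half_pos hε).le, ← dist_eq_norm] at h
  exact h.trans_lt (half_lt_self hε)

end HS

/-! ### The operator `V` of a factorization `Φ(Eᵢⱼ) = ζᵢ ζⱼ*` -/

section Isometry

variable {H₁ : Type*} [NormedAddCommGroup H₁] [InnerProductSpace ℂ H₁] [CompleteSpace H₁]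
variable {H₂ : Type*} [NormedAddCommGroup H₂] [InnerProductSpace ℂ H₂] [CompleteSpace H₂]
variable {K : Type*} [NormedAddCommGroup K] [InnerProductSpace ℂ K] [CompleteSpace K]
variable {I : Type*}

/-- The first amplification, at the pure state `|δ ⊗ v⟩⟨δ ⊗ v|`, already bounds the trace of
`Φ(|v⟩⟨v|) = R R*`. -/
theorem hsNormSq_le_cbNorm {Φ : TraceClass H₁ →ₗ[ℂ] TraceClass H₂} {v : H₁} (hv : ‖v‖ ≤ 1)
    {R : K →L[ℂ] H₂} (hR : (Φ (ketbra v v)).1 = R ∘L ContinuousLinearMap.adjoint R) :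
    hsNormSq R ≤ cbNorm Φ := by
  set δ : EuclideanSpace ℂ (Fin 1) := stdVec 0 with hδ
  have hδ1 : ⟪δ, δ⟫_ℂ = 1 := by simp [hδ]
  have hnδ : ‖δ‖ = 1 := by simp [hδ]
  set w : HilbertTensor (EuclideanSpace ℂ (Fin 1)) H₁ := ketId H₁ δ v with hw
  have h1 : traceNorm (ketbra w w).1 ≤ 1 := by
    rw [ketbra_self_eq, traceNorm_comp_adjoint, hsNormSq_toSpanSingleton, ← ofReal_norm, hw,
      norm_ketId, hnδ, one_mul]
    exact pow_le_one' (ENNReal.ofReal_le_one.2 hv) 2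
  have h2 : (amplification 1 Φ (ketbra w w)).1 =
      (ketId H₂ δ ∘L R) ∘L ContinuousLinearMap.adjoint (ketId H₂ δ ∘L R) := by
    have hs : (⟨entry (ketbra w w).1 δ δ, comp_mem_traceClass (ketbra w w).2 _ _⟩ :
        TraceClass H₁) = ketbra v v := Subtype.ext
      ((entry_ketbra w w δ δ).trans (by rw [hw, braId_ketId, hδ1, one_smul]))
    have h3 : (amplification 1 Φ (ketbra w w)).1 = ketbraTensor δ δ (Φ ⟨entry (ketbra w w).1 δ δ,
        comp_mem_traceClass (ketbra w w).2 _ _⟩).1 := by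
      simp only [amplification, LinearMap.coe_mk, AddHom.coe_mk, Finset.univ_unique,
        Fin.default_eq_zero, Finset.sum_singleton, hδ]
    rw [h3, hs, hR, ContinuousLinearMap.adjoint_comp, adjoint_ketId]
    rfl
  have h3 : hsNormSq (ketId H₂ δ ∘L R) = hsNormSq R := by
    refine tsum_congr fun k => ?_
    rw [ContinuousLinearMap.comp_apply, ← ofReal_norm, norm_ketId, hnδ, one_mul, ofReal_norm]
  rw [← h3, ← traceNorm_comp_adjoint, ← h2]
  exact (le_iSup₂_of_le (f := fun (s : TraceClass (HilbertTensor (EuclideanSpace ℂ (Fin 1)) H₁))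
    (_ : traceNorm s.1 ≤ 1) => traceNorm (amplification 1 Φ s).1) (ketbra w w) h1 le_rfl).trans
    (le_iSup (fun n : ℕ => opTraceNorm (amplification n Φ)) 1)

/-- The factorization `Φ(|xᵢ⟩⟨xⱼ|) = ζᵢ ζⱼ*` passes to linear combinations. -/
theorem map_ketbra_linearCombination {Φ : TraceClass H₁ →ₗ[ℂ] TraceClass H₂} {x : I → H₁}
    {ζ : I → HilbertSchmidt K H₂}
    (h : ∀ i j, (Φ (ketbra (x i) (x j))).1 =
      (ζ i).toCLM ∘L ContinuousLinearMap.adjoint (ζ j).toCLM) (c : I →₀ ℂ) :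
    (Φ (ketbra (Finsupp.linearCombination ℂ x c) (Finsupp.linearCombination ℂ x c))).1 =
      (Finsupp.linearCombination ℂ ζ c).toCLM ∘L
        ContinuousLinearMap.adjoint (Finsupp.linearCombination ℂ ζ c).toCLM := by
  have h1 : ketbra (Finsupp.linearCombination ℂ x c) (Finsupp.linearCombination ℂ x c) =
      ∑ i ∈ c.support, ∑ j ∈ c.support,
        (c i * (starRingEnd ℂ) (c j)) • ketbra (x i) (x j) := by
    refine Subtype.ext ?_
    simp only [AddSubmonoidClass.coe_finsetSum, SetLike.val_smul, ketbra]
    ext z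
    simp only [InnerProductSpace.rankOne_apply, Finsupp.linearCombination_apply, Finsupp.sum,
      sum_apply, smul_apply, sum_inner, inner_smul_left, Finset.smul_sum, smul_smul]
    refine Finset.sum_congr rfl fun i _ => ?_
    rw [Finset.sum_mul, Finset.sum_smul]
    refine Finset.sum_congr rfl fun j _ => ?_
    congr 1
    ring
  rw [h1]
  simp only [map_sum, map_smul, AddSubmonoidClass.coe_finsetSum, SetLike.val_smul, h]
  ext z
  simp only [Finsupp.linearCombination_apply, Finsupp.sum, map_sum, map_smul, map_smulₛₗ, sum_apply,
    smul_apply, ContinuousLinearMap.comp_apply, Finset.smul_sum, smul_smul]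
  refine Eq.trans ?_ Finset.sum_comm
  refine Finset.sum_congr rfl fun i _ => Finset.sum_congr rfl fun j _ => ?_
  congr 1
  ring

theorem denseRange_linearCombination (e : HilbertBasis I ℂ H₁) :
    DenseRange (Finsupp.linearCombination ℂ e) := by
  have h := Submodule.dense_iff_topologicalClosure_eq_top.2 e.dense_span
  rw [← Finsupp.range_linearCombination] at h
  exact h

theorem norm_linearCombination_le (e : HilbertBasis I ℂ H₁)
    {Φ : TraceClass H₁ →ₗ[ℂ] TraceClass H₂} (hΦ : IsCB Φ) {ζ : I → HilbertSchmidt K H₂}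
    (h : ∀ i j, (Φ (ketbra (e i) (e j))).1 =
      (ζ i).toCLM ∘L ContinuousLinearMap.adjoint (ζ j).toCLM) (c : I →₀ ℂ) :
    ‖Finsupp.linearCombination ℂ ζ c‖ ≤
      √(cbNorm Φ).toReal * ‖Finsupp.linearCombination ℂ e c‖ := by
  have hunit : ∀ c : I →₀ ℂ, ‖Finsupp.linearCombination ℂ e c‖ ≤ 1 →
      ‖Finsupp.linearCombination ℂ ζ c‖ ≤ √(cbNorm Φ).toReal := fun c hc => by
    have h1 := hsNormSq_le_cbNorm hc (map_ketbra_linearCombination h c)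
    rw [← HilbertSchmidt.enorm_sq] at h1
    have h2 := ENNReal.toReal_mono hΦ.ne h1
    rw [ENNReal.toReal_pow, toReal_enorm] at h2
    exact Real.le_sqrt_of_sq_le h2
  rcases eq_or_ne (Finsupp.linearCombination ℂ e c) 0 with hv | hv
  · rw [linearIndependent_iff.1 e.orthonormal.linearIndependent c hv]
    simp
  -- The completely bounded norm controls the unit ball only, hence the normalization of `v`.
  · have hv' : 0 < ‖Finsupp.linearCombination ℂ e c‖ := norm_pos_iff.2 hv
    have h1 := hunit (((‖Finsupp.linearCombination ℂ e c‖⁻¹ : ℝ) : ℂ) • c) (by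
      rw [map_smul, norm_smul, Complex.norm_real, norm_inv, norm_norm, inv_mul_cancel₀ hv'.ne'])
    rw [map_smul, norm_smul, Complex.norm_real, norm_inv, norm_norm, inv_mul_le_iff₀ hv'] at h1
    rwa [mul_comm]

theorem IsTP.norm_linearCombination {Φ : TraceClass H₁ →ₗ[ℂ] TraceClass H₂} (hΦ : IsTP Φ)
    {x : I → H₁} {ζ : I → HilbertSchmidt K H₂}
    (h : ∀ i j, (Φ (ketbra (x i) (x j))).1 =
      (ζ i).toCLM ∘L ContinuousLinearMap.adjoint (ζ j).toCLM) (c : I →₀ ℂ) :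
    ‖Finsupp.linearCombination ℂ ζ c‖ = ‖Finsupp.linearCombination ℂ x c‖ := by
  have h1 := hΦ (ketbra (Finsupp.linearCombination ℂ x c) (Finsupp.linearCombination ℂ x c))
  rw [map_ketbra_linearCombination h c, ketbra_self_eq, tr_comp_adjoint, tr_comp_adjoint,
    hsNormSq_toSpanSingleton, ← HilbertSchmidt.enorm_sq, Complex.ofReal_inj, ENNReal.toReal_pow,
    ENNReal.toReal_pow, toReal_enorm, toReal_enorm] at h1
  exact (sq_eq_sq₀ (norm_nonneg _) (norm_nonneg _)).1 h1

end Isometry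

end

end ChoiCholesky

theorem mainTheorem3
    {H₁ : Type*} [NormedAddCommGroup H₁] [InnerProductSpace ℂ H₁] [CompleteSpace H₁]
    {H₂ : Type*} [NormedAddCommGroup H₂] [InnerProductSpace ℂ H₂] [CompleteSpace H₂]
    {I : Type*} [LinearOrder I] [LocallyFiniteOrderBot I] (e : HilbertBasis I ℂ H₁)
    (Φ : TraceClass H₁ →ₗ[ℂ] TraceClass H₂) (hCP : IsCP Φ) (hCB : IsCB Φ) (hFP : IsFP Φ) :
    ∃ ζ : I → HilbertSchmidt (HilbertTensor H₁ H₂) H₂,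
      IsCholeskyResolution e Φ ζ ∧
      (∀ i j, (Φ (ketbra (e i) (e j))).1 =
        (ζ i).toCLM ∘L ContinuousLinearMap.adjoint (ζ j).toCLM) ∧
      (IsTP Φ → Orthonormal ℂ ζ) ∧
      ∃ V : H₁ →L[ℂ] HilbertSchmidt (HilbertTensor H₁ H₂) H₂,
        (∀ i, V (e i) = ζ i) ∧
        (∀ W : H₁ →L[ℂ] HilbertSchmidt (HilbertTensor H₁ H₂) H₂, (∀ i, W (e i) = ζ i) → W = V) ∧
        (IsCC Φ → ‖V‖ ≤ 1) ∧
        (IsTP Φ → Isometry V) := by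
  obtain ⟨ζ, hζ, hΦ⟩ := exists_isCholeskyResolution e Φ hCP hFP
  have hd := denseRange_linearCombination e
  have hbound := norm_linearCombination_le e hCB hΦ
  let V : H₁ →L[ℂ] HilbertSchmidt (HilbertTensor H₁ H₂) H₂ :=
    (Finsupp.linearCombination ℂ ζ).extendOfNorm (Finsupp.linearCombination ℂ e)
  have hV : ∀ c, V (Finsupp.linearCombination ℂ e c) = Finsupp.linearCombination ℂ ζ c :=
    LinearMap.extendOfNorm_eq hd ⟨_, hbound⟩
  have hVe : ∀ i, V (e i) = ζ i := fun i => by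
    have h := hV (Finsupp.single i 1)
    rwa [Finsupp.linearCombination_single, Finsupp.linearCombination_single, one_smul,
      one_smul] at h
  have hiso : IsTP Φ → Isometry V := fun hTP => by
    refine AddMonoidHomClass.isometry_of_norm V fun x => ?_
    refine congrFun (hd.equalizer (g := fun x => ‖V x‖) (h := norm) V.continuous.norm
      continuous_norm (funext fun c => ?_)) x
    change ‖V (Finsupp.linearCombination ℂ e c)‖ = _
    rw [hV, hTP.norm_linearCombination hΦ]
    rfl
  refine ⟨ζ, hζ, hΦ, fun hTP => ?_, V, hVe, fun W hW => ?_, fun hCC => ?_, hiso⟩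
  · have h := e.orthonormal.comp_linearIsometry
      ⟨V.toLinearMap, (AddMonoidHomClass.isometry_iff_norm V).1 (hiso hTP)⟩
    convert h using 1
    exact funext fun i => (hVe i).symm
  · refine ContinuousLinearMap.ext_on
      (Submodule.dense_iff_topologicalClosure_eq_top.2 e.dense_span) ?_
    rintro _ ⟨i, rfl⟩
    rw [hW, hVe]
  · refine (LinearMap.opNorm_extendOfNorm_le hd (Real.sqrt_nonneg _) hbound).trans
      (Real.sqrt_le_one.2 ?_)
    exact ENNReal.toReal_le_of_le_ofReal zero_le_one (by rwa [ENNReal.ofReal_one])
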